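/- **Setting.** A binary $n\times n$ image is a map $M:\{1,\dots,n\}^2\to\{0,1\}$. Two distinct pixels are adjacent if both coordinates differ by at most $1$; a boundary pixel is one that has an adjacent pixel of a different value; $P_M$ is the number of pixels that are boundary pixels of $M$ or lie among the outermost pixels of the square. Fix a real $c\ge 1$. An image-affine transformation is a map $T(p)=\lfloor Ap+t\rfloor$ (coordinatewise floor) with $t\in\mathbb R^2$ and a real $2\times2$ matrix $A$ satisfying $\|v\|/c\le\|Av\|\le c\|v\|$ for all $v\in\mathbb R^2$ (Euclidean norm). Put $$\Delta_T(M_1,M_2)=\frac1{n^2}\Big[\,|\{p: T(p)\notin\{1,\dots,n\}^2\}|+\sum_{p:\,T(p)\in\{1,\dots,n\}^2}|M_1(p)-M_2(T(p))|\,\Big],\qquad \Delta(M_1,M_2)=\min_T\Delta_T(M_1,M_2).$$ A randomized query algorithm (for a given $n$) is a probability distribution over finite adaptive decision trees, each of whose queries reads one pixel of $M_1$ or of $M_2$. For a class $S$ of pairs of binary $n\times n$ images, the algorithm *distinguishes on $S$* if for every $(M_1,M_2)\in S$ it outputs $1$ with probability at least $2/3$ when $\Delta(M_1,M_2)<4/16$,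 and outputs $0$ with probability at least $2/3$ when $\Delta(M_1,M_2)>7/16$. We say that *distinguishing on $S$ needs $b$ queries* if every randomized query algorithm that distinguishes on $S$ makes at least $b$ queries in expectation on some $(M_1,M_2)\in S$ with $\Delta(M_1,M_2)<4/16$ or $\Delta(M_1,M_2)>7/16$. **Theorem.** There are absolute constants $\alpha,\beta,\gamma>0$ such that for every $c\ge1$ the following holds. 1. Let $k:\mathbb N\to[1,\infty)$ satisfy $k(n)=o(n)$. Then for all sufficiently large $n$ (depending on $c$ and $k$), distinguishing on the class of pairs with $$\max(P_{M_1},P_{M_2})\ \ge\ \alpha\,\frac{n^2}{k(n)}$$ needs $\gamma\, n/k(n)$ queries. The same is true on the smaller class of pairs with $$\alpha\,\frac{n^2}{k(n)}\ \le\ \max(P_{M_1},P_{M_2})\ \le\ \beta\,\frac{n^2}{k(n)} .$$ 2. In particular, for all sufficiently large $n$ (depending on $c$), distinguishing on the class of all pairs of binary $n\times n$ images needs $\gamma n$ queries. -/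

import Mathlib

open Filter Asymptotics
open scoped ENNReal

namespace ImageMatching

/-! ### Images, pixels, perimeter -/

/-- The pixels of an `n × n` image; the index `(i, j)` stands for the pixel with coordinates
`(i + 1, j + 1) ∈ {1, …, n}²`. -/
abbrev Pixel (n : ℕ) : Type := Fin n × Fin n

/-- The coordinates of a pixel, a point of `{1, …, n}²`. -/
def Pixel.pos {n : ℕ} (p : Pixel n) : ℤ × ℤ := ((p.1 : ℤ) + 1, (p.2 : ℤ) + 1)

/-- A binary `n × n` image: `true` is the value `1` and `false` the value `0`. -/
abbrev BinaryImage (n : ℕ) : Type := Pixel n → Bool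

/-- The value of a bit as a real number. -/
def bitValue (b : Bool) : ℝ := if b then 1 else 0

/-- Two different pixels are adjacent if both coordinates differ by at most one. -/
def Adjacent {n : ℕ} (p q : Pixel n) : Prop :=
  p ≠ q ∧ |p.pos.1 - q.pos.1| ≤ 1 ∧ |p.pos.2 - q.pos.2| ≤ 1

/-- A boundary pixel has an adjacent pixel of a different value. -/
def IsBoundary {n : ℕ} (M : BinaryImage n) (p : Pixel n) : Prop :=
  ∃ q : Pixel n, Adjacent p q ∧ M p ≠ M q

/-- The outermost pixels of the square. -/
def IsOutermost {n : ℕ} (p : Pixel n) : Prop :=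
  p.pos.1 = 1 ∨ p.pos.1 = n ∨ p.pos.2 = 1 ∨ p.pos.2 = n

open Classical in
/-- The size `P_M` of the perimeter: the number of pixels that are boundary or outermost pixels. -/
noncomputable def perimeter {n : ℕ} (M : BinaryImage n) : ℕ :=
  (Finset.univ.filter fun p : Pixel n => IsBoundary M p ∨ IsOutermost p).card

/-! ### Image-affine transformations and the distance between images -/

/-- The matrix `A` has a scaling factor in the range `[1/c, c]`, for the Euclidean norm. -/
def HasScalingFactor (c : ℝ) (A : Matrix (Fin 2) (Fin 2) ℝ) : Prop :=
  ∀ v : EuclideanSpace ℝ (Fin 2),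
    ‖v‖ / c ≤ ‖Matrix.toEuclideanLin A v‖ ∧ ‖Matrix.toEuclideanLin A v‖ ≤ c * ‖v‖

/-- A pixel as a vector of the plane. -/
noncomputable def Pixel.vec {n : ℕ} (p : Pixel n) : EuclideanSpace ℝ (Fin 2) :=
  !₂[(p.pos.1 : ℝ), (p.pos.2 : ℝ)]

/-- The image-affine transformation `p ↦ ⌊A p + t⌋` based on `A` and `t`. -/
noncomputable def imageAffine {n : ℕ} (A : Matrix (Fin 2) (Fin 2) ℝ)
    (t : EuclideanSpace ℝ (Fin 2)) (p : Pixel n) : ℤ × ℤ :=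
  (⌊(Matrix.toEuclideanLin A p.vec + t) 0⌋, ⌊(Matrix.toEuclideanLin A p.vec + t) 1⌋)

open Classical in
/-- The distance `Δ_T(M₁, M₂)` with respect to `T`: pixels mapped outside `M₂` count `1`, the others
count the difference of the two values; the total is divided by `n²`. (For each `p` there is at most
one pixel `q` with coordinates `T p`.) -/
noncomputable def distWith {n : ℕ} (T : Pixel n → ℤ × ℤ) (M₁ M₂ : BinaryImage n) : ℝ :=
  1 / (n : ℝ) ^ 2 *
    (((Finset.univ.filter fun p : Pixel n => ¬ ∃ q : Pixel n, q.pos = T p).card : ℝ) +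
      ∑ p : Pixel n, ∑ q ∈ Finset.univ.filter (fun q : Pixel n => q.pos = T p),
        |bitValue (M₁ p) - bitValue (M₂ q)|)

/-- The values `Δ_T(M₁, M₂)` for all image-affine transformations `T` with scaling factor in
`[1/c, c]`. -/
def distValues (c : ℝ) {n : ℕ} (M₁ M₂ : BinaryImage n) : Set ℝ :=
  {d | ∃ (A : Matrix (Fin 2) (Fin 2) ℝ) (t : EuclideanSpace ℝ (Fin 2)),
    HasScalingFactor c A ∧ d = distWith (imageAffine A t) M₁ M₂}

/-- The distance `Δ(M₁, M₂)`: the minimum of `Δ_T(M₁, M₂)` over all image-affine transformations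
with scaling factor in `[1/c, c]` (a minimum for `c ≥ 1`, see `imageDist_isLeast`). -/
noncomputable def imageDist (c : ℝ) {n : ℕ} (M₁ M₂ : BinaryImage n) : ℝ :=
  sInf (distValues c M₁ M₂)

theorem distWith_eq_nat_div {n : ℕ} (T : Pixel n → ℤ × ℤ) (M₁ M₂ : BinaryImage n) :
    ∃ m : ℕ, distWith T M₁ M₂ = 1 / (n : ℝ) ^ 2 * (m : ℝ) := by
  classical
  refine ⟨(Finset.univ.filter fun p : Pixel n => ¬ ∃ q : Pixel n, q.pos = T p).card +
      ∑ p : Pixel n, ∑ q ∈ Finset.univ.filter (fun q : Pixel n => q.pos = T p),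
        (if M₁ p = M₂ q then 0 else 1), ?_⟩
  unfold distWith
  push_cast
  congr 2
  refine Finset.sum_congr rfl fun p _ => Finset.sum_congr rfl fun q _ => ?_
  cases M₁ p <;> cases M₂ q <;> simp [bitValue]

theorem imageDist_isLeast {c : ℝ} (hc : 1 ≤ c) {n : ℕ} (M₁ M₂ : BinaryImage n) :
    IsLeast (distValues c M₁ M₂) (imageDist c M₁ M₂) := by
  classical
  have hex : ∃ m : ℕ, 1 / (n : ℝ) ^ 2 * (m : ℝ) ∈ distValues c M₁ M₂ := by
    obtain ⟨m, hm⟩ := distWith_eq_nat_div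
      (imageAffine (1 : Matrix (Fin 2) (Fin 2) ℝ) (0 : EuclideanSpace ℝ (Fin 2))) M₁ M₂
    refine ⟨m, 1, 0, fun v => ?_, hm.symm⟩
    have h1 : Matrix.toEuclideanLin (1 : Matrix (Fin 2) (Fin 2) ℝ) v = v := by
      ext i; simp [Matrix.toEuclideanLin]
    rw [h1]
    exact ⟨div_le_self (norm_nonneg v) hc, le_mul_of_one_le_left (norm_nonneg v) hc⟩
  have hleast : IsLeast (distValues c M₁ M₂) (1 / (n : ℝ) ^ 2 * (Nat.find hex : ℝ)) := by
    refine ⟨Nat.find_spec hex, ?_⟩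
    rintro d hd
    obtain ⟨A, t, hA, rfl⟩ := id hd
    obtain ⟨m, hm⟩ := distWith_eq_nat_div (imageAffine A t) M₁ M₂
    rw [hm] at hd ⊢
    exact mul_le_mul_of_nonneg_left (by exact_mod_cast Nat.find_min' hex hd) (by positivity)
  have h := hleast.csInf_eq
  unfold imageDist
  rw [h]
  exact hleast

/-! ### Query algorithms -/

/-- A deterministic (adaptive) query algorithm on pairs of binary `n × n` images: it either stops
with an answer, or queries a pixel (`Sum.inl p` asks for `M₁ p`, `Sum.inr p` for `M₂ p`) and
continues depending on the value read. -/
inductive QueryTree (n : ℕ) : Type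
  | answer (b : Bool) : QueryTree n
  | query (x : Pixel n ⊕ Pixel n) (next : Bool → QueryTree n) : QueryTree n

namespace QueryTree

/-- The answer of the algorithm on the input `(M₁, M₂)`. -/
def output {n : ℕ} (M₁ M₂ : BinaryImage n) : QueryTree n → Bool
  | answer b => b
  | query x next => (next (Sum.elim M₁ M₂ x)).output M₁ M₂

/-- The number of queries that the algorithm makes on the input `(M₁, M₂)`. -/
def numQueries {n : ℕ} (M₁ M₂ : BinaryImage n) : QueryTree n → ℕ
  | answer _ => 0
  | query x next => (next (Sum.elim M₁ M₂ x)).numQueries M₁ M₂ + 1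

end QueryTree

/-- A randomized query algorithm is a probability distribution over deterministic ones. -/
abbrev RandomizedAlgorithm (n : ℕ) : Type := PMF (QueryTree n)

/-- The probability that the algorithm answers `b` on the input `(M₁, M₂)`. -/
noncomputable def RandomizedAlgorithm.probOutput {n : ℕ} (𝒜 : RandomizedAlgorithm n)
    (M₁ M₂ : BinaryImage n) (b : Bool) : ℝ≥0∞ :=
  𝒜.toOuterMeasure {D | D.output M₁ M₂ = b}

/-- The expected number of queries on the input `(M₁, M₂)`. -/
noncomputable def RandomizedAlgorithm.expectedQueries {n : ℕ} (𝒜 : RandomizedAlgorithm n)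
    (M₁ M₂ : BinaryImage n) : ℝ≥0∞ :=
  ∑' D : QueryTree n, 𝒜 D * (D.numQueries M₁ M₂ : ℝ≥0∞)

/-- On every pair of images in the class `S`, the algorithm answers `1` with probability at least
`2/3` if `Δ(M₁, M₂) < 4/16`, and `0` with probability at least `2/3` if `Δ(M₁, M₂) > 7/16`. -/
def Distinguishes (c : ℝ) {n : ℕ} (S : Set (BinaryImage n × BinaryImage n))
    (𝒜 : RandomizedAlgorithm n) : Prop :=
  ∀ M₁ M₂ : BinaryImage n, (M₁, M₂) ∈ S →
    (imageDist c M₁ M₂ < 4 / 16 → 2 / 3 ≤ 𝒜.probOutput M₁ M₂ true) ∧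
    (7 / 16 < imageDist c M₁ M₂ → 2 / 3 ≤ 𝒜.probOutput M₁ M₂ false)

/-- Every randomized algorithm that distinguishes the two cases on the class `S` makes at least `b`
queries in expectation on some input from `S` that falls under one of the two cases. -/
def NeedsQueries (c : ℝ) {n : ℕ} (S : Set (BinaryImage n × BinaryImage n)) (b : ℝ) : Prop :=
  ∀ 𝒜 : RandomizedAlgorithm n, Distinguishes c S 𝒜 →
    ∃ M₁ M₂ : BinaryImage n, (M₁, M₂) ∈ S ∧
      (imageDist c M₁ M₂ < 4 / 16 ∨ 7 / 16 < imageDist c M₁ M₂) ∧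
      ENNReal.ofReal b ≤ 𝒜.expectedQueries M₁ M₂

/-- `max(P_{M₁}, P_{M₂})` as a real number. -/
noncomputable def maxPerimeter {n : ℕ} (M : BinaryImage n × BinaryImage n) : ℝ :=
  ((max (perimeter M.1) (perimeter M.2) : ℕ) : ℝ)

end ImageMatching

open ImageMatching

namespace ImageMatching

/-! ### Elementary facts on the distance -/

/-! Cut the square into blocks of side `s = ⌈k⌉` and let `m = n / s`, so that `m` has order `n / k`.
Both images are constant on blocks. The first one has fixed vertical stripes in its top `m / 64`
rows of blocks and random bits elsewhere; the stripes force a perimeter of order `n ^ 2 / k`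
whatever the bits are, and the block structure bounds it from above by the same order. The second
image carries either independent random bits or a copy of the first image's unstriped bits
translated by a vector `v` of blocks, drawn from a square of side `m / 16`.

With a planted translate the distance is always below `4/16`: the translation by `s * v` errs only
on the stripes and near two sides of the square (`imageDist_blockImage_le`). With independent bits
it exceeds `7/16` for at least nine tenths of the pairs (`exists_card_imageDist_le`). Indeed,
restricting an affine map to pixels with one position inside their blocks gives an affine map of
blocks followed by a floor. The relevant maps of this kind number only `exp (O (m log m))`, while a
fixed one has markedly fewer than half mismatches with probability `exp (-Ω (m ^ 2))`, so a union
bound applies.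

A decision tree can tell the two cases apart only by reading a pixel and a pixel in the translate of
its block. A set of `Q` queried pixels realizes at most `Q ^ 2` translation vectors, against order
`m ^ 2` candidates. For the other vectors, exchanging bits embeds the independent inputs into the
planted ones without changing what the tree sees (`QueryTree.card_mul_card_le`). Averaging over
inputs, vectors and trees contradicts correctness when `Q` is a small multiple of `m`
(`needsQueries_of_blockImages`). -/

theorem Pixel.pos_injective {n : ℕ} : Function.Injective (Pixel.pos (n := n)) := by
  rintro ⟨a, b⟩ ⟨c, d⟩ h
  simp only [Pixel.pos, Prod.mk.injEq] at h
  ext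
  · show (a : ℕ) = c
    omega
  · show (b : ℕ) = d
    omega

-- The two kinds of error merge: for a pixel mapped outside the square the condition on `q` is
-- vacuous, so it is counted as well.
open Classical in
theorem distWith_eq_card {n : ℕ} (T : Pixel n → ℤ × ℤ) (M₁ M₂ : BinaryImage n) :
    distWith T M₁ M₂ = 1 / (n : ℝ) ^ 2 *
      ((Finset.univ.filter fun p : Pixel n => ∀ q : Pixel n, q.pos = T p → M₁ p ≠ M₂ q).card : ℝ) := by
  unfold distWith
  congr 1
  rw [Finset.card_filter, Finset.card_filter]
  push_cast
  rw [← Finset.sum_add_distrib]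
  refine Finset.sum_congr rfl fun p _ => ?_
  by_cases h : ∃ q : Pixel n, q.pos = T p
  · obtain ⟨q, hq⟩ := h
    have hf : (Finset.univ.filter fun q : Pixel n => q.pos = T p) = {q} := by
      ext r
      simp only [Finset.mem_filter, Finset.mem_univ, true_and, Finset.mem_singleton]
      exact ⟨fun hr => Pixel.pos_injective (hr.trans hq.symm), fun hr => hr ▸ hq⟩
    have hi : (∀ r : Pixel n, r.pos = T p → M₁ p ≠ M₂ r) ↔ M₁ p ≠ M₂ q :=
      ⟨fun hr => hr q hq, fun hr r hr' => Pixel.pos_injective (hr'.trans hq.symm) ▸ hr⟩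
    rw [hf, Finset.sum_singleton, if_neg (not_not.mpr ⟨q, hq⟩)]
    simp only [hi]
    cases M₁ p <;> cases M₂ q <;> simp [bitValue]
  · have hf : (Finset.univ.filter fun q : Pixel n => q.pos = T p) = ∅ := by
      ext r
      simp only [Finset.mem_filter, Finset.mem_univ, true_and, Finset.notMem_empty, iff_false]
      exact fun hr => h ⟨r, hr⟩
    rw [hf, if_pos h, if_pos fun q hq => absurd ⟨q, hq⟩ h]
    simp

theorem toEuclideanLin_fin_two (A : Matrix (Fin 2) (Fin 2) ℝ) (x y : ℝ) (i : Fin 2) :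
    Matrix.toEuclideanLin A !₂[x, y] i = A i 0 * x + A i 1 * y := by
  fin_cases i <;> simp [Matrix.toEuclideanLin]

theorem imageAffine_eq {n : ℕ} (A : Matrix (Fin 2) (Fin 2) ℝ) (t : EuclideanSpace ℝ (Fin 2))
    (p : Pixel n) :
    imageAffine A t p = (⌊A 0 0 * (p.pos.1 : ℝ) + A 0 1 * (p.pos.2 : ℝ) + t 0⌋,
      ⌊A 1 0 * (p.pos.1 : ℝ) + A 1 1 * (p.pos.2 : ℝ) + t 1⌋) := by
  unfold imageAffine Pixel.vec
  simp only [PiLp.add_apply, toEuclideanLin_fin_two]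

/-! ### Images that are constant on square blocks -/

/-- The indices of the blocks of side length `s` that meet an `n × n` image. -/
abbrev Block (n s : ℕ) : Type := Fin (n / s + 1) × Fin (n / s + 1)

/-- The index of the block along one coordinate. -/
def blockCoord {n : ℕ} (s : ℕ) (x : Fin n) : Fin (n / s + 1) :=
  ⟨(x : ℕ) / s, Nat.lt_succ_of_le (Nat.div_le_div_right x.2.le)⟩

/-- The block that contains a pixel. -/
def blockOf {n : ℕ} (s : ℕ) (p : Pixel n) : Block n s := (blockCoord s p.1, blockCoord s p.2)

/-- The image that has the value `x g` on the block `g`. -/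
def blockImage {n s : ℕ} (x : Block n s → Bool) : BinaryImage n := fun p => x (blockOf s p)

/-- The bits `a`, replaced by vertical stripes in the first `L` rows of blocks. -/
def striped {n s : ℕ} (L : ℕ) (a : Block n s → Bool) : Block n s → Bool :=
  fun g => if (g.1 : ℕ) < L then decide ((g.2 : ℕ) % 2 = 0) else a g

theorem mod_eq_of_div_ne {s a b : ℕ} (hs : 0 < s) (h : |((a : ℤ) + 1) - ((b : ℤ) + 1)| ≤ 1)
    (hd : a / s ≠ b / s) : a % s = 0 ∨ a % s = s - 1 := by
  by_contra hcon
  push Not at hcon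
  have ha := Nat.div_add_mod a s
  have hm := Nat.mod_lt a hs
  rw [abs_le] at h
  apply hd
  symm
  apply Nat.div_eq_of_lt_le
  · rw [mul_comm]; omega
  · rw [Nat.succ_mul, mul_comm]; omega

theorem card_filter_mod_eq_le (n s r : ℕ) :
    (Finset.univ.filter fun y : Fin n => (y : ℕ) % s = r).card ≤ n / s + 1 := by
  rw [← Finset.card_range (n / s + 1)]
  refine Finset.card_le_card_of_injOn (fun y => (y : ℕ) / s) ?_ ?_
  · intro y _
    simpa using Nat.lt_succ_of_le (Nat.div_le_div_right (c := s) y.2.le)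
  · intro y hy z hz h
    simp only [Finset.coe_filter, Finset.mem_univ, true_and, Set.mem_ofPred_eq] at hy hz h
    ext
    rw [← Nat.div_add_mod (y : ℕ) s, ← Nat.div_add_mod (z : ℕ) s, hy, hz, h]

theorem perimeter_blockImage_le {n s : ℕ} (hs : 0 < s) (x : Block n s → Bool) :
    perimeter (blockImage x) ≤ 2 * n * (2 * (n / s + 1) + 1) := by
  classical
  unfold perimeter
  -- Boundary pixels sit in the first or last line of a block. The last line of the square needs its
  -- own clause because the final block may be cut off.
  set B : Finset (Fin n) := Finset.univ.filter fun y : Fin n =>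
    ((y : ℕ) % s = 0 ∨ (y : ℕ) % s = s - 1) ∨ (y : ℕ) + 1 = n with hB
  have hBc : B.card ≤ 2 * (n / s + 1) + 1 := by
    rw [hB, Finset.filter_or, Finset.filter_or]
    refine (Finset.card_union_le _ _).trans ?_
    have h1 := (Finset.card_union_le (Finset.univ.filter fun y : Fin n => (y : ℕ) % s = 0)
      (Finset.univ.filter fun y : Fin n => (y : ℕ) % s = s - 1))
    have h2 := card_filter_mod_eq_le n s 0
    have h3 := card_filter_mod_eq_le n s (s - 1)
    have h4 : (Finset.univ.filter fun y : Fin n => (y : ℕ) + 1 = n).card ≤ 1 := by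
      rw [Finset.card_le_one]
      intro y hy z hz
      simp only [Finset.mem_filter, Finset.mem_univ, true_and] at hy hz
      ext
      omega
    omega
  have hsub : (Finset.univ.filter fun p : Pixel n =>
      IsBoundary (blockImage x) p ∨ IsOutermost p) ⊆ B ×ˢ Finset.univ ∪ Finset.univ ×ˢ B := by
    rintro ⟨y, z⟩ hp
    simp only [Finset.mem_filter, Finset.mem_univ, true_and] at hp
    simp only [Finset.mem_union, Finset.mem_product, Finset.mem_univ, and_true, true_and, hB,
      Finset.mem_filter]
    rcases hp with ⟨q, ⟨-, h1, h2⟩, hne⟩ | h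
    · have : (y : ℕ) / s ≠ (q.1 : ℕ) / s ∨ (z : ℕ) / s ≠ (q.2 : ℕ) / s := by
        by_contra hcon
        push Not at hcon
        apply hne
        show x _ = x _
        congr 1
        simp only [blockOf, blockCoord, Prod.mk.injEq, Fin.mk.injEq]
        exact hcon
      rcases this with h | h
      · exact Or.inl (Or.inl (mod_eq_of_div_ne hs h1 h))
      · exact Or.inr (Or.inl (mod_eq_of_div_ne hs h2 h))
    · simp only [IsOutermost, Pixel.pos] at h
      rcases h with h | h | h | h
      · have : (y : ℕ) = 0 := by omega
        simp [this]
      · have : (y : ℕ) + 1 = n := by omega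
        simp [this]
      · have : (z : ℕ) = 0 := by omega
        simp [this]
      · have : (z : ℕ) + 1 = n := by omega
        simp [this]
  refine (Finset.card_le_card hsub).trans ((Finset.card_union_le _ _).trans ?_)
  rw [Finset.card_product, Finset.card_product, Finset.card_univ, Fintype.card_fin]
  nlinarith

/-- Neighbouring stripes have opposite values, so in the striped rows the left edge of every block
column but the first consists of boundary pixels. No assumption on `a` enters, so every input of the
construction lies in the required class. -/
theorem le_perimeter_striped {n s L : ℕ} (hs : 0 < s) (hL : L ≤ n / s) (a : Block n s → Bool) :
    L * s * (n / s - 1) ≤ perimeter (blockImage (striped L a)) := by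
  classical
  unfold perimeter
  have hms : n / s * s ≤ n := Nat.div_mul_le_self n s
  have hc : (Finset.range (L * s) ×ˢ Finset.Ico 1 (n / s)).card = L * s * (n / s - 1) := by
    rw [Finset.card_product, Finset.card_range, Nat.card_Ico]
  rw [← hc]
  refine Finset.card_le_card_of_surjOn (fun p : Pixel n => ((p.1 : ℕ), (p.2 : ℕ) / s)) ?_
  rintro ⟨y, j⟩ hyj
  simp only [Finset.coe_product, Finset.coe_range, Finset.coe_Ico, Set.mem_prod, Set.mem_Iio,
    Set.mem_Ico] at hyj
  obtain ⟨hy, hj1, hj2⟩ := hyj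
  have hyn : y < n := hy.trans_le ((Nat.mul_le_mul_right s hL).trans hms)
  have hjn : s * j < n := by
    rw [mul_comm]
    exact ((Nat.mul_lt_mul_right hs).mpr hj2).trans_le hms
  have hjs : s ≤ s * j := Nat.le_mul_of_pos_right s hj1
  refine ⟨((⟨y, hyn⟩, ⟨s * j, hjn⟩) : Pixel n), ?_, by simp [hs]⟩
  simp only [Finset.coe_filter, Finset.mem_univ, true_and, Set.mem_ofPred_eq]
  refine Or.inl ⟨(⟨y, hyn⟩, ⟨s * j - 1, by omega⟩), ⟨?_, ?_, ?_⟩, ?_⟩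
  · intro h
    have := congrArg (fun p : Pixel n => (p.2 : ℕ)) h
    simp only at this
    omega
  · simp [Pixel.pos]
  · simp only [Pixel.pos]
    rw [abs_le]
    constructor <;> omega
  · have hyL : y / s < L := Nat.div_lt_of_lt_mul (by rwa [mul_comm])
    have h1 : s * j / s = j := Nat.mul_div_cancel_left j hs
    have h2 : (s * j - 1) / s = j - 1 := by
      obtain ⟨i, rfl⟩ : ∃ i, j = i + 1 := ⟨j - 1, by omega⟩
      apply Nat.div_eq_of_lt_le
      · rw [Nat.add_sub_cancel, mul_comm, Nat.mul_succ]; omega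
      · rw [Nat.add_sub_cancel, mul_comm s, Nat.succ_mul]
        have := Nat.succ_mul i s
        omega
    simp only [blockImage, striped, blockOf, blockCoord, hyL, if_true, h1, h2, ne_eq, decide_eq_decide]
    omega

/-! ### Pairs of images at a small distance -/

theorem card_filter_le_add (n r : ℕ) :
    (Finset.univ.filter fun y : Fin n => n ≤ (y : ℕ) + r).card ≤ r := by
  refine le_of_le_of_eq ?_ (Finset.card_range r)
  refine Finset.card_le_card_of_injOn (fun y => (y : ℕ) + r - n) ?_ ?_
  · intro y hy
    simp only [Finset.coe_filter, Finset.mem_univ, true_and, Set.mem_ofPred_eq] at hy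
    simp only [Finset.coe_range, Set.mem_Iio]
    omega
  · intro y hy z hz h
    simp only [Finset.coe_filter, Finset.mem_univ, true_and, Set.mem_ofPred_eq] at hy hz h
    ext
    omega

theorem card_filter_lt_le (n r : ℕ) :
    (Finset.univ.filter fun y : Fin n => (y : ℕ) < r).card ≤ r := by
  refine le_of_le_of_eq ?_ (Finset.card_range r)
  refine Finset.card_le_card_of_injOn (fun y => (y : ℕ)) ?_ ?_
  · intro y hy
    simpa using hy
  · intro y _ z _ h
    exact Fin.ext h

theorem hasScalingFactor_one {c : ℝ} (hc : 1 ≤ c) : HasScalingFactor c 1 := by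
  intro v
  have h1 : Matrix.toEuclideanLin (1 : Matrix (Fin 2) (Fin 2) ℝ) v = v := by
    ext i; simp [Matrix.toEuclideanLin]
  rw [h1]
  exact ⟨div_le_self (norm_nonneg v) hc, le_mul_of_one_le_left (norm_nonneg v) hc⟩

theorem imageDist_blockImage_le {c : ℝ} (hc : 1 ≤ c) {n s L v₁ v₂ : ℕ} (hs : 0 < s)
    (x₁ x₂ : Block n s → Bool)
    (hx : ∀ g h : Block n s, L ≤ (g.1 : ℕ) → (h.1 : ℕ) = g.1 + v₁ → (h.2 : ℕ) = g.2 + v₂ →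
      x₁ g = x₂ h) :
    imageDist c (blockImage x₁) (blockImage x₂) ≤
      1 / (n : ℝ) ^ 2 * ((n * (s * (v₁ + v₂ + L)) : ℕ) : ℝ) := by
  classical
  have hle := (imageDist_isLeast hc (blockImage x₁) (blockImage x₂)).2
    ⟨1, !₂[(s : ℝ) * v₁, (s : ℝ) * v₂], hasScalingFactor_one hc, rfl⟩
  refine hle.trans ?_
  rw [distWith_eq_card]
  refine mul_le_mul_of_nonneg_left ?_ (by positivity)
  have hT : ∀ p : Pixel n, imageAffine 1 !₂[(s : ℝ) * v₁, (s : ℝ) * v₂] p =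
      (p.pos.1 + s * v₁, p.pos.2 + s * v₂) := by
    intro p
    rw [imageAffine_eq]
    simp only [Matrix.one_apply_eq, one_mul, Matrix.cons_val_zero,
      Matrix.cons_val_one, ne_eq, zero_ne_one, one_ne_zero, not_false_eq_true,
      Matrix.one_apply_ne, zero_mul, add_zero, zero_add, Prod.mk.injEq]
    constructor
    · rw [Int.floor_eq_iff]
      push_cast
      constructor <;> linarith
    · rw [Int.floor_eq_iff]
      push_cast
      constructor <;> linarith
  -- A pixel can fail only by leaving the square in one of the two directions or by lying in the
  -- striped rows.
  have hsub : (Finset.univ.filter fun p : Pixel n => ∀ q : Pixel n,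
      q.pos = imageAffine 1 !₂[(s : ℝ) * v₁, (s : ℝ) * v₂] p →
        blockImage x₁ p ≠ blockImage x₂ q) ⊆
      ((Finset.univ.filter fun y : Fin n => n ≤ (y : ℕ) + s * v₁) ×ˢ Finset.univ ∪
        Finset.univ ×ˢ (Finset.univ.filter fun y : Fin n => n ≤ (y : ℕ) + s * v₂)) ∪
        (Finset.univ.filter fun y : Fin n => (y : ℕ) < s * L) ×ˢ Finset.univ := by
    rintro ⟨y, z⟩ hp
    simp only [Finset.mem_filter, Finset.mem_univ, true_and, hT] at hp
    simp only [Finset.mem_union, Finset.mem_product, Finset.mem_univ, and_true, true_and,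
      Finset.mem_filter]
    by_contra hcon
    push Not at hcon
    obtain ⟨⟨h1, h2⟩, h3⟩ := hcon
    refine hp (⟨y + s * v₁, h1⟩, ⟨z + s * v₂, h2⟩) ?_ ?_
    · simp only [Pixel.pos, Prod.mk.injEq]
      push_cast
      constructor <;> ring
    · refine hx _ _ ?_ ?_ ?_
      · simp only [blockOf, blockCoord]
        rwa [Nat.le_div_iff_mul_le hs, mul_comm]
      · simp only [blockOf, blockCoord]
        rw [Nat.add_mul_div_left _ _ hs]
      · simp only [blockOf, blockCoord]
        rw [Nat.add_mul_div_left _ _ hs]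
  have hcard := (Finset.card_le_card hsub).trans ((Finset.card_union_le _ _).trans
    (Nat.add_le_add_right (Finset.card_union_le _ _) _))
  simp only [Finset.card_product, Finset.card_univ, Fintype.card_fin] at hcard
  have h1 := Nat.mul_le_mul_right n (card_filter_le_add n (s * v₁))
  have h2 := Nat.mul_le_mul_left n (card_filter_le_add n (s * v₂))
  have h3 := Nat.mul_le_mul_right n (card_filter_lt_le n (s * L))
  refine Nat.cast_le.mpr (hcard.trans ((Nat.add_le_add (Nat.add_le_add h1 h2) h3).trans_eq ?_))
  ring

/-! ### The pixels read by a query algorithm -/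

namespace QueryTree

/-- The set of pixels that the algorithm queries on the input `(M₁, M₂)`. -/
def queried {n : ℕ} (M₁ M₂ : BinaryImage n) : QueryTree n → Finset (Pixel n ⊕ Pixel n)
  | answer _ => ∅
  | query x next => insert x ((next (Sum.elim M₁ M₂ x)).queried M₁ M₂)

theorem card_queried_le {n : ℕ} (M₁ M₂ : BinaryImage n) (D : QueryTree n) :
    (D.queried M₁ M₂).card ≤ D.numQueries M₁ M₂ := by
  induction D with
  | answer b => simp [queried, numQueries]
  | query x next ih =>
    simp only [queried, numQueries]
    exact (Finset.card_insert_le _ _).trans (Nat.add_le_add_right (ih _) 1)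

/-- The path followed in the tree depends only on the values read along it. -/
theorem output_and_queried_congr {n : ℕ} {M₁ M₂ N₁ N₂ : BinaryImage n} (D : QueryTree n)
    (h : ∀ x ∈ D.queried M₁ M₂, Sum.elim N₁ N₂ x = Sum.elim M₁ M₂ x) :
    D.output N₁ N₂ = D.output M₁ M₂ ∧ D.queried N₁ N₂ = D.queried M₁ M₂ := by
  induction D with
  | answer b => exact ⟨rfl, rfl⟩
  | query x next ih =>
    simp only [queried, Finset.mem_insert, forall_eq_or_imp] at h
    obtain ⟨h1, h2⟩ := ih _ h.2
    simp only [output, queried, h.1, h1, h2, and_self]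

end QueryTree

/-! ### Exchanging bits along a partial matching -/

section Exchange

variable {X Y : Type*} [DecidableEq Y] (E : Y → Prop) (g : Y → X) (W : Finset Y)

open Classical in
/-- Exchange the bit of `y` with the bit of `g y`, for all `y ∈ W` with `E y`. -/
noncomputable def exchange (z : (X → Bool) × (Y → Bool)) : (X → Bool) × (Y → Bool) :=
  (fun x => if h : ∃ y, y ∈ W ∧ E y ∧ g y = x then z.2 h.choose else z.1 x,
    fun y => if y ∈ W ∧ E y then z.1 (g y) else z.2 y)

variable {E g W}

theorem exchange_fst_apply (hg : ∀ y y', E y → E y' → g y = g y' → y = y')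
    (z : (X → Bool) × (Y → Bool)) {y : Y} (hy : y ∈ W) (hE : E y) :
    (exchange E g W z).1 (g y) = z.2 y := by
  have h : ∃ y', y' ∈ W ∧ E y' ∧ g y' = g y := ⟨y, hy, hE, rfl⟩
  simp only [exchange]
  rw [dif_pos h, hg _ _ h.choose_spec.2.1 hE h.choose_spec.2.2]

theorem exchange_fst_of_forall_ne (z : (X → Bool) × (Y → Bool)) {x : X}
    (hx : ∀ y ∈ W, E y → g y ≠ x) : (exchange E g W z).1 x = z.1 x := by
  simp only [exchange]
  rw [dif_neg]
  rintro ⟨y, h1, h2, h3⟩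
  exact hx y h1 h2 h3

theorem exchange_snd_of_mem (z : (X → Bool) × (Y → Bool)) {y : Y} (hy : y ∈ W) (hE : E y) :
    (exchange E g W z).2 y = z.1 (g y) := by
  simp only [exchange]
  rw [if_pos ⟨hy, hE⟩]

theorem exchange_snd_of_not (z : (X → Bool) × (Y → Bool)) {y : Y} (hy : ¬ (y ∈ W ∧ E y)) :
    (exchange E g W z).2 y = z.2 y := by
  simp only [exchange]
  rw [if_neg hy]

/-- For a fixed `W` no bit is lost: each old bit can be read off at its partner, partners being
unique by `hg`. -/
theorem exchange_injective (hg : ∀ y y', E y → E y' → g y = g y' → y = y') :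
    Function.Injective (exchange E g W : (X → Bool) × (Y → Bool) → _) := by
  intro z z' h
  refine Prod.ext (funext fun x => ?_) (funext fun y => ?_)
  · by_cases hx : ∃ y, y ∈ W ∧ E y ∧ g y = x
    · obtain ⟨y, hy, hE, rfl⟩ := hx
      rw [← exchange_snd_of_mem z hy hE, ← exchange_snd_of_mem z' hy hE, h]
    · have hx' : ∀ y ∈ W, E y → g y ≠ x := fun y h1 h2 h3 => hx ⟨y, h1, h2, h3⟩
      rw [← exchange_fst_of_forall_ne z hx', ← exchange_fst_of_forall_ne z' hx', h]
  · by_cases hy : y ∈ W ∧ E y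
    · rw [← exchange_fst_apply hg z hy.1 hy.2, ← exchange_fst_apply hg z' hy.1 hy.2, h]
    · rw [← exchange_snd_of_not z hy, ← exchange_snd_of_not z' hy, h]

end Exchange

/-! ### Planting a translate of the first image into the second one -/

/-- The translate of the block `h` by `-v`. -/
def shiftBack {n s : ℕ} (v : ℕ × ℕ) (h : Block n s) : Block n s :=
  (⟨(h.1 : ℕ) - v.1, (Nat.sub_le _ _).trans_lt h.1.2⟩,
    ⟨(h.2 : ℕ) - v.2, (Nat.sub_le _ _).trans_lt h.2.2⟩)

/-- The block `h` is the translate by `v` of a block outside the first `L` rows. -/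
def IsShift {n s : ℕ} (L : ℕ) (v : ℕ × ℕ) (h : Block n s) : Prop :=
  L + v.1 ≤ h.1 ∧ v.2 ≤ h.2

instance {n s : ℕ} (L : ℕ) (v : ℕ × ℕ) (h : Block n s) : Decidable (IsShift L v h) :=
  inferInstanceAs (Decidable (_ ∧ _))

/-- Replace the bits `b` by the translate of the bits `a` by `v`, where this is possible. -/
def plant {n s : ℕ} (L : ℕ) (v : ℕ × ℕ) (a b : Block n s → Bool) : Block n s → Bool :=
  fun h => if IsShift L v h then a (shiftBack v h) else b h

theorem shiftBack_injOn {n s L : ℕ} {v : ℕ × ℕ} (h h' : Block n s) (hh : IsShift L v h)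
    (hh' : IsShift L v h') (he : shiftBack v h = shiftBack v h') : h = h' := by
  simp only [shiftBack, Prod.mk.injEq, Fin.mk.injEq] at he
  simp only [IsShift] at hh hh'
  ext <;> omega

theorem striped_eq_plant {n s L : ℕ} {v : ℕ × ℕ} (a b : Block n s → Bool) (g h : Block n s)
    (hg : L ≤ (g.1 : ℕ)) (h1 : (h.1 : ℕ) = g.1 + v.1) (h2 : (h.2 : ℕ) = g.2 + v.2) :
    striped L a g = plant L v a b h := by
  have hs : shiftBack v h = g := by
    simp only [shiftBack]
    ext <;> simp only <;> omega
  have hS : IsShift L v h := ⟨by omega, by omega⟩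
  simp only [striped, plant, if_neg (not_lt.mpr hg), if_pos hS, hs]

/-- The bits of a random pair of block images. -/
abbrev BlockBits (n s : ℕ) : Type := (Block n s → Bool) × (Block n s → Bool)

namespace QueryTree

variable {n s : ℕ} (L : ℕ) (D : QueryTree n)

/-- The set of pixels queried on the pair of images with independent bits. -/
def farQueried (z : BlockBits n s) : Finset (Pixel n ⊕ Pixel n) :=
  D.queried (blockImage (striped L z.1)) (blockImage z.2)

/-- The algorithm queries a pixel and its translate. -/
def Collides (v : ℕ × ℕ) (z : BlockBits n s) : Prop :=
  ∃ p q : Pixel n, Sum.inl p ∈ D.farQueried L z ∧ Sum.inr q ∈ D.farQueried L z ∧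
    IsShift L v (blockOf s q) ∧ shiftBack v (blockOf s q) = blockOf s p

-- The vector `v` is the difference of the blocks of the two colliding pixels, hence determined by a
-- pair of queried pixels.
open Classical in
theorem card_collides_le (V : Finset (ℕ × ℕ)) (z : BlockBits n s) :
    (V.filter fun v => D.Collides L v z).card ≤ (D.farQueried L z).card ^ 2 := by
  set S := D.farQueried L z
  have hsub : (V.filter fun v => D.Collides L v z) ⊆
      (S ×ˢ S).image fun x : (Pixel n ⊕ Pixel n) × (Pixel n ⊕ Pixel n) =>
        (((blockOf s (Sum.elim id id x.2)).1 : ℕ) - (blockOf s (Sum.elim id id x.1)).1,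
          ((blockOf s (Sum.elim id id x.2)).2 : ℕ) - (blockOf s (Sum.elim id id x.1)).2) := by
    intro v hv
    simp only [Finset.mem_filter] at hv
    obtain ⟨-, p, q, hp, hq, hS, he⟩ := hv
    refine Finset.mem_image.mpr ⟨(Sum.inl p, Sum.inr q), Finset.mem_product.mpr ⟨hp, hq⟩, ?_⟩
    rw [Prod.ext_iff, Fin.ext_iff, Fin.ext_iff] at he
    simp only [shiftBack] at he
    simp only [IsShift] at hS
    simp only [Sum.elim_inl, Sum.elim_inr, id]
    ext <;> simp only <;> omega
  refine (Finset.card_le_card hsub).trans (Finset.card_image_le.trans ?_)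
  rw [Finset.card_product, sq]

open Classical in
/-- The blocks of the second image in which the algorithm queries a pixel. -/
noncomputable def queriedBlocks (S : Finset (Pixel n ⊕ Pixel n)) : Finset (Block n s) :=
  Finset.univ.filter fun y => ∃ q, Sum.inr q ∈ S ∧ blockOf s q = y

/-- In the planted image a queried block of the second image shows the bit of its partner in the
first, which after the exchange is the bit seen before. The displaced bits of the first image go to
places that planting overwrites, so they are kept but invisible. Without a collision no queried
pixel of the first image is affected. -/
theorem output_and_queried_exchange {v : ℕ × ℕ} {z : BlockBits n s} (hz : ¬ D.Collides L v z) :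
    let z' := exchange (IsShift L v) (shiftBack v) (queriedBlocks (D.farQueried L z)) z
    D.output (blockImage (striped L z'.1)) (blockImage (plant L v z'.1 z'.2)) =
        D.output (blockImage (striped L z.1)) (blockImage z.2) ∧
      D.queried (blockImage (striped L z'.1)) (blockImage (plant L v z'.1 z'.2)) =
        D.farQueried L z := by
  intro z'
  refine D.output_and_queried_congr ?_
  rintro (p | q) hx
  · simp only [Sum.elim_inl, blockImage, striped]
    split_ifs
    · rfl
    · refine exchange_fst_of_forall_ne z ?_
      intro y hy hE he
      simp only [queriedBlocks, Finset.mem_filter, Finset.mem_univ, true_and] at hy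
      obtain ⟨q, hq, rfl⟩ := hy
      exact hz ⟨p, q, hx, hq, hE, he⟩
  · have hW : blockOf s q ∈ queriedBlocks (s := s) (D.farQueried L z) := by
      simp only [queriedBlocks, Finset.mem_filter, Finset.mem_univ, true_and]
      exact ⟨q, hx, rfl⟩
    simp only [Sum.elim_inr, blockImage, plant]
    split_ifs with hE
    · exact exchange_fst_apply shiftBack_injOn z hW hE
    · exact exchange_snd_of_not z fun h => hE h.2

-- The set of exchanged blocks depends on `z`, so `exchange_injective` does not apply at once. But
-- the transcript survives the exchange: two inputs with the same image have the same queried set,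
-- hence the same set of exchanged blocks.
open Classical in
theorem card_not_collides_le (v : ℕ × ℕ) (β : Bool) (P : BlockBits n s → Prop)
    (hP : ∀ z, P z → D.output (blockImage (striped L z.1)) (blockImage z.2) = β) :
    (Finset.univ.filter fun z : BlockBits n s => P z ∧ ¬ D.Collides L v z).card ≤
      (Finset.univ.filter fun z : BlockBits n s =>
        D.output (blockImage (striped L z.1)) (blockImage (plant L v z.1 z.2)) = β).card := by
  refine Finset.card_le_card_of_injOn (fun z =>
    exchange (IsShift L v) (shiftBack v) (queriedBlocks (D.farQueried L z)) z) ?_ ?_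
  · intro z hz
    simp only [Finset.coe_filter, Finset.mem_univ, true_and, Set.mem_ofPred_eq] at hz ⊢
    rw [(D.output_and_queried_exchange L hz.2).1, hP z hz.1]
  · intro z hz z' hz' he
    simp only [Finset.coe_filter, Finset.mem_univ, true_and, Set.mem_ofPred_eq] at hz hz' he
    have h1 := (D.output_and_queried_exchange L hz.2).2
    have h2 := (D.output_and_queried_exchange L hz'.2).2
    rw [← he, h1] at h2
    rw [← h2] at he
    exact exchange_injective shiftBack_injOn he

open Classical in
/-- An algorithm that makes few queries hardly notices a planted random translate. -/
theorem card_mul_card_le (V : Finset (ℕ × ℕ)) (β : Bool) (Q : ℕ) :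
    V.card * (Finset.univ.filter fun z : BlockBits n s =>
        D.output (blockImage (striped L z.1)) (blockImage z.2) = β ∧
          D.numQueries (blockImage (striped L z.1)) (blockImage z.2) ≤ Q).card ≤
      ∑ v ∈ V, (Finset.univ.filter fun z : BlockBits n s =>
        D.output (blockImage (striped L z.1)) (blockImage (plant L v z.1 z.2)) = β).card +
      Q ^ 2 * (Finset.univ.filter fun z : BlockBits n s =>
        D.output (blockImage (striped L z.1)) (blockImage z.2) = β ∧
          D.numQueries (blockImage (striped L z.1)) (blockImage z.2) ≤ Q).card := by
  set P : BlockBits n s → Prop := fun z =>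
    D.output (blockImage (striped L z.1)) (blockImage z.2) = β ∧
      D.numQueries (blockImage (striped L z.1)) (blockImage z.2) ≤ Q with hP
  have h1 : ∀ v ∈ V, (Finset.univ.filter P).card ≤
      (Finset.univ.filter fun z : BlockBits n s =>
        D.output (blockImage (striped L z.1)) (blockImage (plant L v z.1 z.2)) = β).card +
      ((Finset.univ.filter P).filter fun z => D.Collides L v z).card := by
    intro v _
    have h2 := D.card_not_collides_le L v β P fun z hz => hz.1
    rw [← Finset.filter_filter] at h2
    have h3 := Finset.card_filter_add_card_filter_not (s := Finset.univ.filter P)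
      (fun z => D.Collides L v z)
    rw [← h3, add_comm]
    refine Nat.add_le_add_right ?_ _
    convert h2
  have h4 : ∑ v ∈ V, ((Finset.univ.filter P).filter fun z => D.Collides L v z).card ≤
      Q ^ 2 * (Finset.univ.filter P).card := by
    simp only [Finset.card_filter _ (Finset.univ.filter P)]
    -- Count collisions per input instead of per vector; an input in `P` has at most `Q ^ 2` of
    -- them.
    rw [Finset.sum_comm, mul_comm]
    refine Finset.sum_le_card_nsmul _ _ _ fun z hz => ?_
    rw [← Finset.card_filter]
    refine (D.card_collides_le L V z).trans (Nat.pow_le_pow_left ?_ 2)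
    exact (D.card_queried_le _ _).trans (Finset.mem_filter.mp hz).2.2
  have h5 := Finset.sum_le_sum h1
  rw [Finset.sum_const, smul_eq_mul, Finset.sum_add_distrib] at h5
  exact h5.trans (Nat.add_le_add_left h4 _)

end QueryTree

/-! ### A tail bound for the number of mismatches -/

/-- The generating function factorizes over the bits: each bit in `G` contributes `1 + z`, each
other one `2`. -/
theorem sum_pow_card_mismatch {X : Type*} [Fintype X] [DecidableEq X] (G : Finset X) (f : X → Bool)
    (z : ℝ) :
    ∑ a : X → Bool, z ^ (G.filter fun x => a x ≠ f x).card =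
      2 ^ Fintype.card X * ((1 + z) / 2) ^ G.card := by
  have h1 : ∀ a : X → Bool, z ^ (G.filter fun x => a x ≠ f x).card =
      ∏ x, if x ∈ G then (if a x ≠ f x then z else 1) else 1 := by
    intro a
    rw [Finset.prod_ite_mem, Finset.univ_inter, Finset.prod_ite, Finset.prod_const_one,
      Finset.prod_const, mul_one]
  simp only [h1]
  have h2 := Finset.prod_univ_sum (fun _ : X => (Finset.univ : Finset Bool))
    (fun x b => if x ∈ G then (if b ≠ f x then z else 1) else (1 : ℝ))
  rw [Fintype.piFinset_univ] at h2
  rw [← h2]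
  have h3 : ∀ x, (∑ b : Bool, if x ∈ G then (if b ≠ f x then z else 1) else (1 : ℝ)) =
      2 * (if x ∈ G then (1 + z) / 2 else 1) := by
    intro x
    rw [Fintype.sum_bool]
    by_cases h : x ∈ G
    · simp only [h, if_true]
      cases f x <;> simp <;> ring
    · simp only [h, if_false]
      norm_num
  rw [Finset.prod_congr rfl fun x _ => h3 x, Finset.prod_mul_distrib, Finset.prod_const,
    Finset.card_univ, Finset.prod_ite_mem, Finset.univ_inter, Finset.prod_const]

/-- The base of the exponential tail bound `card_few_mismatches_le`. -/
noncomputable def tailBase : ℝ := (1 + (255 / 256) ^ 32) / 2 / (255 / 256) ^ 15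

theorem tailBase_pos : 0 < tailBase := by
  unfold tailBase; positivity

theorem tailBase_lt_one : tailBase < 1 := by
  unfold tailBase; norm_num

/-- Markov's inequality for `z ^ mismatches` with `z = (255/256) ^ 32`. The threshold `15/32` lies
below the mean `1/2`, which makes `tailBase < 1` possible, and above `7/16`, which leaves room for
the stripes and the incomplete blocks. -/
theorem card_few_mismatches_le {X : Type*} [Fintype X] [DecidableEq X] (G : Finset X)
    (f : X → Bool) :
    ((Finset.univ.filter fun a : X → Bool =>
      32 * (G.filter fun x => a x ≠ f x).card ≤ 15 * G.card).card : ℝ) ≤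
      2 ^ Fintype.card X * tailBase ^ G.card := by
  set S := Finset.univ.filter fun a : X → Bool =>
      32 * (G.filter fun x => a x ≠ f x).card ≤ 15 * G.card with hS
  have h1 : (S.card : ℝ) * (255 / 256) ^ (15 * G.card) ≤
      ∑ a : X → Bool, ((255 / 256 : ℝ) ^ 32) ^ (G.filter fun x => a x ≠ f x).card := by
    rw [← nsmul_eq_mul]
    refine (Finset.card_nsmul_le_sum S _ _ ?_).trans
      (Finset.sum_le_sum_of_subset_of_nonneg (Finset.subset_univ S) fun _ _ _ => by positivity)
    intro a ha
    rw [← pow_mul]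
    exact pow_le_pow_of_le_one (by norm_num) (by norm_num) (Finset.mem_filter.mp ha).2
  rw [sum_pow_card_mismatch] at h1
  have h2 : tailBase ^ G.card =
      ((1 + (255 / 256 : ℝ) ^ 32) / 2) ^ G.card / (255 / 256) ^ (15 * G.card) := by
    rw [tailBase, div_pow, pow_mul]
  rw [h2, ← mul_div_assoc, le_div_iff₀ (by positivity)]
  exact h1

/-! ### Encoding integer parts of sums -/

/-- A code for a function `(i, j) ↦ ⌊u i + w j⌋`: the integer parts of `u i` and `w j`, and the
ranks of their fractional parts. -/
abbrev FloorCode (M K : ℕ) : Type := Fin M → (Fin K × Fin K) × Fin K × Fin K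

/-- The function that belongs to a code. -/
def FloorCode.decode {M K : ℕ} (K₀ : ℕ) (e : FloorCode M K) (i j : Fin M) : ℤ :=
  (((e i).1.1 : ℕ) - (K₀ : ℤ)) + (((e j).1.2 : ℕ) - (K₀ : ℤ)) +
    if (e j).2.2 ≤ (e i).2.1 then 1 else 0

theorem FloorCode.card (M K : ℕ) : Fintype.card (FloorCode M K) = (K ^ 4) ^ M := by
  simp only [Fintype.card_fun, Fintype.card_prod, Fintype.card_fin]
  congr 1
  ring

/-- Comparisons with the numbers `w j` are decided by ranks alone, so finitely many codes capture
all real parameters. -/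
theorem card_filter_le_iff {ι : Type*} [Fintype ι] (w : ι → ℝ) (x : ℝ) (j : ι) :
    (Finset.univ.filter fun j' => w j' ≤ w j).card ≤ (Finset.univ.filter fun j' => w j' ≤ x).card ↔
      w j ≤ x := by
  constructor
  · intro h
    by_contra hx
    push Not at hx
    refine absurd h (not_le.mpr (Finset.card_lt_card ?_))
    rw [Finset.ssubset_iff_of_subset]
    · exact ⟨j, by simp, by simpa using hx⟩
    · intro j' hj'
      simp only [Finset.mem_filter, Finset.mem_univ, true_and] at hj' ⊢
      exact hj'.trans hx.le
  · intro h
    refine Finset.card_le_card ?_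
    intro j' hj'
    simp only [Finset.mem_filter, Finset.mem_univ, true_and] at hj' ⊢
    exact hj'.trans h

/-- The floor of a sum is the sum of the floors plus a carry, and the carry occurs exactly when `1 -
fract (w j) ≤ fract (u i)`. The bounds on `K` make room for floors in `[-K₀, K₀]` and ranks in `[0,
M]`. -/
theorem exists_floorCode {M K K₀ : ℕ} (hK : 2 * K₀ + 1 ≤ K) (hM : M + 1 ≤ K) (u w : Fin M → ℝ)
    (hu : ∀ i, |u i| ≤ K₀) (hw : ∀ j, |w j| ≤ K₀) :
    ∃ e : FloorCode M K, ∀ i j, e.decode K₀ i j = ⌊u i + w j⌋ := by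
  have hfl : ∀ x : ℝ, |x| ≤ K₀ → -(K₀ : ℤ) ≤ ⌊x⌋ ∧ ⌊x⌋ ≤ K₀ := by
    intro x hx
    rw [abs_le] at hx
    constructor
    · rw [Int.le_floor]; push_cast; exact hx.1
    · have : (⌊x⌋ : ℝ) ≤ (K₀ : ℤ) := (Int.floor_le x).trans (by exact_mod_cast hx.2)
      exact_mod_cast this
  have hc : ∀ x : ℝ, (Finset.univ.filter fun j' => 1 - Int.fract (w j') ≤ x).card < K := by
    intro x
    have := Finset.card_le_univ (Finset.univ.filter fun j' => 1 - Int.fract (w j') ≤ x)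
    rw [Fintype.card_fin] at this
    omega
  refine ⟨fun i => ((⟨(⌊u i⌋ + K₀).toNat, ?_⟩, ⟨(⌊w i⌋ + K₀).toNat, ?_⟩), ⟨_, hc (Int.fract (u i))⟩,
    ⟨_, hc (1 - Int.fract (w i))⟩), ?_⟩
  · have := hfl _ (hu i); omega
  · have := hfl _ (hw i); omega
  · intro i j
    have h1 := hfl _ (hu i)
    have h2 := hfl _ (hw j)
    simp only [FloorCode.decode, Fin.mk_le_mk]
    rw [Int.toNat_of_nonneg (by omega), Int.toNat_of_nonneg (by omega)]
    simp only [card_filter_le_iff (fun j' => 1 - Int.fract (w j'))]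
    have h3 := Int.floor_add_fract (u i)
    have h4 := Int.floor_add_fract (w j)
    have h5 := Int.fract_lt_one (u i)
    have h6 := Int.fract_lt_one (w j)
    have h7 := Int.fract_nonneg (u i)
    have h8 := Int.fract_nonneg (w j)
    symm
    rw [Int.floor_eq_iff]
    split_ifs with h <;> push_cast <;> constructor <;> linarith

/-! ### Mismatches of block images -/

/-- The blocks outside the first `L` rows that lie inside the image. -/
def innerBlocks (n s L : ℕ) : Finset (Block n s) :=
  Finset.univ.filter fun g => L ≤ (g.1 : ℕ) ∧ (g.1 : ℕ) < n / s ∧ (g.2 : ℕ) < n / s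

open Classical in
/-- The inner blocks that `τ` maps outside the image or to a block with a different bit. -/
noncomputable def mismatches {n s : ℕ} (L : ℕ) (τ : Block n s → ℤ × ℤ) (a b : Block n s → Bool) :
    Finset (Block n s) :=
  (innerBlocks n s L).filter fun g => ∀ h : Block n s, (((h.1 : ℕ) : ℤ), ((h.2 : ℕ) : ℤ)) = τ g →
    a g ≠ b h

theorem card_innerBlocks {n s L : ℕ} : (innerBlocks n s L).card = (n / s - L) * (n / s) := by
  rw [← Nat.card_Ico L, ← Finset.card_range (n / s), ← Finset.card_product]
  refine Finset.card_bij (fun g _ => ((g.1 : ℕ), (g.2 : ℕ))) ?_ ?_ ?_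
  · intro g hg
    simp only [innerBlocks, Finset.mem_filter, Finset.mem_univ, true_and] at hg
    simp only [Finset.mem_product, Finset.mem_Ico, Finset.mem_range, Finset.card_range]
    omega
  · intro g _ h _ he
    simp only [Prod.mk.injEq] at he
    ext
    exacts [he.1, he.2]
  · rintro ⟨i, j⟩ hij
    simp only [Finset.mem_product, Finset.mem_Ico, Finset.mem_range, Finset.card_range] at hij
    refine ⟨(⟨i, by omega⟩, ⟨j, by omega⟩), ?_, rfl⟩
    simp only [innerBlocks, Finset.mem_filter, Finset.mem_univ, true_and]
    omega

open Classical in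
theorem card_few_mismatches_map_le {n s L : ℕ} (τ : Block n s → ℤ × ℤ) (b : Block n s → Bool) :
    ((Finset.univ.filter fun a : Block n s → Bool =>
      32 * (mismatches L τ a b).card ≤ 15 * (innerBlocks n s L).card).card : ℝ) ≤
      2 ^ Fintype.card (Block n s) * tailBase ^ (innerBlocks n s L).card := by
  -- The value `false` for blocks mapped outside is harmless: these always belong to `mismatches`,
  -- so comparing with `f` can only lower the count.
  set f : Block n s → Bool := fun g =>
    if h : ∃ h : Block n s, (((h.1 : ℕ) : ℤ), ((h.2 : ℕ) : ℤ)) = τ g then b h.choose else false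
  refine le_trans (Nat.cast_le.mpr (Finset.card_le_card ?_))
    (card_few_mismatches_le (innerBlocks n s L) f)
  intro a ha
  simp only [Finset.mem_filter, Finset.mem_univ, true_and] at ha ⊢
  refine le_trans (Nat.mul_le_mul_left _ (Finset.card_le_card ?_)) ha
  intro g hg
  simp only [Finset.mem_filter] at hg
  refine Finset.mem_filter.mpr ⟨hg.1, fun h hh => ?_⟩
  have hex : ∃ h : Block n s, (((h.1 : ℕ) : ℤ), ((h.2 : ℕ) : ℤ)) = τ g := ⟨h, hh⟩
  have hc : hex.choose = h := by
    have := hex.choose_spec.trans hh.symm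
    simp only [Prod.mk.injEq, Nat.cast_inj] at this
    ext
    exacts [this.1, this.2]
  have h2 := hg.2
  simp only [f] at h2
  rwa [dif_pos hex, hc] at h2

/-- The map of block indices that comes from an affine map. -/
noncomputable def blockAffine {n s : ℕ} (A : Matrix (Fin 2) (Fin 2) ℝ) (t : Fin 2 → ℝ)
    (g : Block n s) : ℤ × ℤ :=
  (⌊A 0 0 * ((g.1 : ℕ) : ℝ) + t 0 + A 0 1 * ((g.2 : ℕ) : ℝ)⌋,
    ⌊A 1 0 * ((g.1 : ℕ) : ℝ) + t 1 + A 1 1 * ((g.2 : ℕ) : ℝ)⌋)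

/-- Taking the integer part before dividing by `s` does not change the floor of the quotient. The
shifts by one arise because coordinates start at `1` and indices at `0`. -/
theorem int_div_eq_floor {s : ℕ} (hs : 0 < s) (x α β t : ℝ) (i o j o' q : ℕ)
    (hx : x = α * (((s * i + o : ℕ) : ℝ) + 1) + β * (((s * j + o' : ℕ) : ℝ) + 1) + t)
    (hq : ((q : ℤ) + 1) = ⌊x⌋) :
    ((q / s : ℕ) : ℤ) = ⌊α * i + (α * (o + 1) + β * (o' + 1) + t - 1) / s + β * j⌋ := by
  have hs' : (s : ℝ) ≠ 0 := by positivity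
  have h1 : α * i + (α * (o + 1) + β * (o' + 1) + t - 1) / s + β * j = (x - 1) / s := by
    rw [hx]
    push_cast
    field_simp
    ring
  rw [h1, Int.floor_div_natCast, Int.floor_sub_one, ← hq]
  push_cast
  simp

open Classical in
/-- Every affine map of the pixels restricts, on the pixels with the same position within their
block, to an affine map of the blocks. -/
theorem exists_card_mismatches_le {n s L : ℕ} (hs : 0 < s) (A : Matrix (Fin 2) (Fin 2) ℝ)
    (t : EuclideanSpace ℝ (Fin 2)) (a b : Block n s → Bool) :
    ∃ t' : Fin 2 → ℝ, ((s : ℝ) ^ 2 * (mismatches L (blockAffine A t') a b).card) ≤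
      n ^ 2 * distWith (imageAffine A t) (blockImage (striped L a)) (blockImage b) := by
  rcases Nat.eq_zero_or_pos n with rfl | hn
  · refine ⟨0, ?_⟩
    have : mismatches L (blockAffine A 0) a b = ∅ := by
      ext g
      simp [mismatches, innerBlocks]
    simp [this]
  rw [distWith_eq_card]
  have hn' : (n : ℝ) ≠ 0 := by positivity
  set B := Finset.univ.filter fun p : Pixel n => ∀ q : Pixel n, q.pos = imageAffine A t p →
    blockImage (striped L a) p ≠ blockImage b q with hB
  rw [← mul_assoc, mul_one_div_cancel (by positivity), one_mul]
  have hfib := Finset.card_eq_sum_card_fiberwise (s := B)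
    (f := fun p => (((p.1 : ℕ) % s, (p.2 : ℕ) % s) : ℕ × ℕ))
    (t := Finset.range s ×ˢ Finset.range s) (by
      intro p _
      simp [Nat.mod_lt _ hs])
  have hne : (Finset.range s ×ˢ Finset.range s).Nonempty := ⟨(0, 0), by simp [hs]⟩
  -- Some offset inside the blocks carries at most the average share `1 / s ^ 2` of the bad pixels.
  obtain ⟨o, ho, hle⟩ : ∃ o ∈ Finset.range s ×ˢ Finset.range s,
      ((B.filter fun p => (((p.1 : ℕ) % s, (p.2 : ℕ) % s) : ℕ × ℕ) = o).card : ℝ) ≤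
        (B.card : ℝ) / s ^ 2 := by
    refine Finset.exists_le_of_sum_le hne ?_
    rw [Finset.sum_const, Finset.card_product, Finset.card_range, nsmul_eq_mul, Nat.cast_mul, ← sq,
      mul_div_cancel₀ _ (by positivity), ← Nat.cast_sum, ← hfib]
  refine ⟨fun d => (A d 0 * (o.1 + 1) + A d 1 * (o.2 + 1) + t d - 1) / s, ?_⟩
  rw [le_div_iff₀ (by positivity)] at hle
  refine le_trans ?_ hle
  rw [mul_comm]
  refine mul_le_mul_of_nonneg_right (Nat.cast_le.mpr ?_) (by positivity)
  refine Finset.card_le_card_of_surjOn (fun p => blockOf s p) ?_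
  rintro ⟨i, j⟩ hg
  simp only [mismatches, innerBlocks, Finset.coe_filter, Finset.mem_filter, Finset.mem_univ,
    true_and, Set.mem_ofPred_eq] at hg
  obtain ⟨⟨hL, hi, hj⟩, hmis⟩ := hg
  simp only [Finset.mem_product, Finset.mem_range] at ho
  have hms : s * (n / s) ≤ n := Nat.mul_div_le n s
  have hlt : ∀ x r : ℕ, x < n / s → r < s → s * x + r < n := by
    intro x r hx hr
    have : s * (x + 1) ≤ s * (n / s) := Nat.mul_le_mul_left s hx
    rw [Nat.mul_succ] at this
    omega
  have hdiv : ∀ x r : ℕ, r < s → (s * x + r) / s = x := by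
    intro x r hr
    rw [Nat.mul_add_div hs, Nat.div_eq_of_lt hr, add_zero]
  have hblk : blockOf s ((⟨s * i + o.1, hlt _ _ hi ho.1⟩, ⟨s * j + o.2, hlt _ _ hj ho.2⟩) : Pixel n)
      = (i, j) := by
    simp only [blockOf, blockCoord, hdiv _ _ ho.1, hdiv _ _ ho.2]
  refine ⟨(⟨s * i + o.1, hlt _ _ hi ho.1⟩, ⟨s * j + o.2, hlt _ _ hj ho.2⟩), ?_, hblk⟩
  simp only [hB, Finset.coe_filter, Finset.mem_filter, Finset.mem_univ, true_and,
    Set.mem_ofPred_eq]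
  refine ⟨fun q hq => ?_, ?_⟩
  · have h1 : blockImage (striped L a)
        ((⟨s * i + o.1, hlt _ _ hi ho.1⟩, ⟨s * j + o.2, hlt _ _ hj ho.2⟩) : Pixel n) = a (i, j) := by
      simp only [blockImage, hblk, striped, if_neg (not_lt.mpr hL)]
    rw [h1]
    refine hmis (blockOf s q) ?_
    rw [imageAffine_eq] at hq
    simp only [Pixel.pos, Prod.mk.injEq] at hq
    simp only [blockAffine, blockOf, blockCoord, Prod.mk.injEq]
    refine ⟨int_div_eq_floor hs _ (A 0 0) (A 0 1) (t 0) i o.1 j o.2 q.1 ?_ hq.1,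
      int_div_eq_floor hs _ (A 1 0) (A 1 1) (t 1) i o.1 j o.2 q.2 ?_ hq.2⟩
    · push_cast; ring
    · push_cast; ring
  · simp [Nat.mod_eq_of_lt ho.1, Nat.mod_eq_of_lt ho.2]

theorem HasScalingFactor.abs_apply_le {c : ℝ} {A : Matrix (Fin 2) (Fin 2) ℝ}
    (hA : HasScalingFactor c A) (i j : Fin 2) : |A i j| ≤ c := by
  have h1 := (hA (EuclideanSpace.single j 1)).2
  rw [PiLp.norm_single, norm_one, mul_one] at h1
  have h2 := PiLp.norm_apply_le (Matrix.toEuclideanLin A (EuclideanSpace.single j 1)) i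
  rw [Real.norm_eq_abs] at h2
  have h3 : Matrix.toEuclideanLin A (EuclideanSpace.single j 1) i = A i j := by
    simp [Matrix.toEuclideanLin]
  rw [h3] at h2
  exact h2.trans h1

/-- The translation part is a priori unbounded. One block `g₀` that stays inside the image bounds
it: `A d 0 * i + t d` differs from a coordinate in range by two terms of size at most `C * (n / s +
1)`, up to rounding. -/
theorem exists_floorCode_blockAffine {c : ℝ} {C n s : ℕ} (hC : 1 ≤ C) (hc : c ≤ C)
    {A : Matrix (Fin 2) (Fin 2) ℝ} (hA : HasScalingFactor c A) (t : Fin 2 → ℝ) (g₀ h₀ : Block n s)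
    (h : (((h₀.1 : ℕ) : ℤ), ((h₀.2 : ℕ) : ℤ)) = blockAffine A t g₀) :
    ∃ e : Fin 2 → FloorCode (n / s + 1) (7 * C * (n / s + 1)), ∀ g : Block n s,
      blockAffine A t g = ((e 0).decode (3 * C * (n / s + 1)) g.1 g.2,
        (e 1).decode (3 * C * (n / s + 1)) g.1 g.2) := by
  have key : ∀ (d : Fin 2) (k : Fin (n / s + 1)),
      ((k : ℕ) : ℤ) = ⌊A d 0 * ((g₀.1 : ℕ) : ℝ) + t d + A d 1 * ((g₀.2 : ℕ) : ℝ)⌋ →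
      ∃ e : FloorCode (n / s + 1) (7 * C * (n / s + 1)), ∀ i j,
        e.decode (3 * C * (n / s + 1)) i j =
          ⌊(A d 0 * ((i : ℕ) : ℝ) + t d) + A d 1 * ((j : ℕ) : ℝ)⌋ := by
    intro d k hk
    have hCM : n / s + 1 ≤ C * (n / s + 1) := Nat.le_mul_of_pos_left _ hC
    have hCM' : ((n / s + 1 : ℕ) : ℝ) ≤ C * (n / s + 1 : ℕ) := by exact_mod_cast hCM
    have hcoord : ∀ i : Fin (n / s + 1), (0 : ℝ) ≤ (i : ℕ) ∧ ((i : ℕ) : ℝ) ≤ (n / s + 1 : ℕ) :=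
      fun i => ⟨Nat.cast_nonneg _, Nat.cast_le.mpr i.2.le⟩
    have hM0 : (0 : ℝ) ≤ (n / s + 1 : ℕ) := Nat.cast_nonneg _
    have hmul : ∀ (d' : Fin 2) (x : ℝ), |x| ≤ (n / s + 1 : ℕ) →
        |A d d' * x| ≤ C * (n / s + 1 : ℕ) := by
      intro d' x hx
      rw [abs_mul]
      exact mul_le_mul ((hA.abs_apply_le d d').trans hc) hx (abs_nonneg _) (Nat.cast_nonneg _)
    have hM1 : 1 ≤ n / s + 1 := Nat.succ_pos _
    refine exists_floorCode (by rw [mul_assoc, mul_assoc]; omega) (by rw [mul_assoc]; omega) (fun i => A d 0 * ((i : ℕ) : ℝ) + t d)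
      (fun j => A d 1 * ((j : ℕ) : ℝ)) ?_ ?_
    · intro i
      have h1 := hmul 0 (((i : ℕ) : ℝ) - ((g₀.1 : ℕ) : ℝ)) (by
        rw [abs_le]
        have := hcoord i
        have := hcoord g₀.1
        constructor <;> linarith)
      have h2 := hmul 1 ((g₀.2 : ℕ) : ℝ) (by
        rw [abs_of_nonneg (hcoord g₀.2).1]
        exact (hcoord g₀.2).2)
      have h3 := Int.floor_eq_iff.mp hk.symm
      have h4 : ((k : ℕ) : ℝ) + 1 ≤ (n / s + 1 : ℕ) := by exact_mod_cast k.2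
      have h5 := (hcoord k).1
      rw [abs_le] at h1 h2
      push_cast at h1 h2 h3 h4 hCM' ⊢
      rw [abs_le]
      constructor <;> linarith
    · intro j
      refine (hmul 1 _ ?_).trans ?_
      · rw [abs_of_nonneg (hcoord j).1]
        exact (hcoord j).2
      · push_cast at hCM' hM0 ⊢
        nlinarith
  simp only [blockAffine, Prod.mk.injEq] at h
  obtain ⟨e₀, he₀⟩ := key 0 h₀.1 h.1
  obtain ⟨e₁, he₁⟩ := key 1 h₀.2 h.2
  refine ⟨![e₀, e₁], fun g => ?_⟩
  simp only [Matrix.cons_val_zero, Matrix.cons_val_one, he₀, he₁, blockAffine]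

/-- Since `m - L ≥ m / 2`, the product is at most the `m`-th power of `(D * (m + 1)) ^ 16 *
√tailBase ^ m`, which tends to zero. -/
theorem exists_forall_card_codes_mul_le (D : ℕ) : ∃ m₀ : ℕ, ∀ m L : ℕ, m₀ ≤ m → 2 * L ≤ m →
    10 * ((((D * (m + 1)) ^ 4) ^ (m + 1)) ^ 2 * tailBase ^ ((m - L) * m)) ≤ (1 : ℝ) := by
  rcases Nat.eq_zero_or_pos D with rfl | hD
  · exact ⟨0, fun m L _ _ => by simp⟩
  set r : ℝ := Real.sqrt tailBase with hr
  have hr0 : 0 < r := Real.sqrt_pos.mpr tailBase_pos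
  have hr2 : r ^ 2 = tailBase := Real.sq_sqrt tailBase_pos.le
  have hr1 : r < 1 := by
    rw [hr, Real.sqrt_lt' one_pos, one_pow]
    exact tailBase_lt_one
  have h1 := tendsto_pow_const_mul_const_pow_of_abs_lt_one 16 (r := r) (by rwa [abs_of_pos hr0])
  have h2 := ((tendsto_add_atTop_iff_nat 1).mpr h1).const_mul ((D : ℝ) ^ 16 * r⁻¹)
  rw [mul_zero] at h2
  obtain ⟨m₀, hm₀⟩ := eventually_atTop.mp (h2.eventually (gt_mem_nhds (show (0 : ℝ) < 1 / 10 by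
    norm_num)))
  refine ⟨m₀ + 1, fun m L hm hL => ?_⟩
  have h3 := hm₀ m (by omega)
  have h4 : (D : ℝ) ^ 16 * r⁻¹ * (((m + 1 : ℕ) : ℝ) ^ 16 * r ^ (m + 1)) =
      ((D : ℝ) * (m + 1)) ^ 16 * r ^ m := by
    rw [pow_succ r m]
    push_cast
    field_simp
  rw [h4] at h3
  have hK : (1 : ℝ) ≤ (D : ℝ) * (m + 1) := by
    have : 1 ≤ D * (m + 1) := Nat.mul_pos hD (Nat.succ_pos m)
    exact_mod_cast this
  have h5 : ((((D : ℝ) * (m + 1)) ^ 4) ^ (m + 1)) ^ 2 ≤ (((D : ℝ) * (m + 1)) ^ 16) ^ m := by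
    rw [← pow_mul, ← pow_mul, ← pow_mul]
    exact pow_le_pow_right₀ hK (by omega)
  have h6 : tailBase ^ ((m - L) * m) ≤ (r ^ m) ^ m := by
    rw [← hr2, ← pow_mul, ← pow_mul, ← mul_assoc]
    exact pow_le_pow_of_le_one hr0.le hr1.le (Nat.mul_le_mul_right m (by omega))
  have h7 : ((((D : ℝ) * (m + 1)) ^ 4) ^ (m + 1)) ^ 2 * tailBase ^ ((m - L) * m) ≤
      (((D : ℝ) * (m + 1)) ^ 16 * r ^ m) ^ m := by
    refine (mul_le_mul h5 h6 (pow_nonneg tailBase_pos.le _) ?_).trans_eq (mul_pow _ _ _).symm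
    positivity
  have h8 : (((D : ℝ) * (m + 1)) ^ 16 * r ^ m) ^ m ≤ ((D : ℝ) * (m + 1)) ^ 16 * r ^ m :=
    pow_le_of_le_one (by positivity) (h3.le.trans (by norm_num)) (by omega)
  linarith

open Classical in
/-- Most pairs of block images with independent random bits have a distance above `7/16`. -/
theorem exists_card_imageDist_le {c : ℝ} (hc : 1 ≤ c) : ∃ m₀ : ℕ, ∀ n s : ℕ, 0 < s → m₀ ≤ n / s →
    10 * ((Finset.univ.filter fun z : BlockBits n s =>
      imageDist c (blockImage (striped (n / s / 64) z.1)) (blockImage z.2) ≤ 7 / 16).card : ℝ) ≤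
      Fintype.card (BlockBits n s) := by
  obtain ⟨C, hC⟩ := exists_nat_ge c
  have hC1 : 1 ≤ C := by exact_mod_cast hc.trans hC
  obtain ⟨m₀, hm₀⟩ := exists_forall_card_codes_mul_le (7 * C)
  refine ⟨max m₀ 64, fun n s hs hm => ?_⟩
  set m := n / s with hm_def
  set L := m / 64 with hL
  have hm1 : m₀ ≤ m := (le_max_left _ _).trans hm
  have hm2 : 64 ≤ m := (le_max_right _ _).trans hm
  have hG : (innerBlocks n s L).card = (m - L) * m := card_innerBlocks
  have hG' : 14 * (m + 1) ^ 2 ≤ 15 * (innerBlocks n s L).card := by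
    have h1 : 63 * m ≤ 64 * (m - L) := by omega
    have h2 := Nat.mul_le_mul_right m h1
    rw [hG]
    nlinarith
  let τ : (Fin 2 → FloorCode (m + 1) (7 * C * (m + 1))) → Block n s → ℤ × ℤ := fun e g =>
    ((e 0).decode (3 * C * (m + 1)) g.1 g.2, (e 1).decode (3 * C * (m + 1)) g.1 g.2)
  have hsub : (Finset.univ.filter fun z : BlockBits n s =>
      imageDist c (blockImage (striped L z.1)) (blockImage z.2) ≤ 7 / 16) ⊆
      (Finset.univ : Finset (Fin 2 → FloorCode (m + 1) (7 * C * (m + 1)))).biUnion fun e =>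
        Finset.univ.filter fun z : BlockBits n s =>
          32 * (mismatches L (τ e) z.1 z.2).card ≤ 15 * (innerBlocks n s L).card := by
    intro z hz
    simp only [Finset.mem_filter, Finset.mem_univ, true_and] at hz
    obtain ⟨A, t, hA, hd⟩ :=
      (imageDist_isLeast hc (blockImage (striped L z.1)) (blockImage z.2)).1
    obtain ⟨t', ht'⟩ := exists_card_mismatches_le (L := L) hs A t z.1 z.2
    rw [← hd] at ht'
    have hn : (n : ℝ) ≤ s * (m + 1) := by
      have : n < s * (m + 1) := Nat.lt_mul_div_succ n hs
      exact_mod_cast this.le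
    have hs' : (0 : ℝ) < (s : ℝ) ^ 2 := by positivity
    have h1 : (32 * (mismatches L (blockAffine A t') z.1 z.2).card : ℝ) ≤ 14 * (m + 1) ^ 2 := by
      have h2 : (n : ℝ) ^ 2 ≤ (s * (m + 1)) ^ 2 := pow_le_pow_left₀ (Nat.cast_nonneg n) hn 2
      have h3 : (s : ℝ) ^ 2 * (mismatches L (blockAffine A t') z.1 z.2).card ≤
          (s : ℝ) ^ 2 * (7 / 16 * (m + 1) ^ 2) := by
        refine ht'.trans ((mul_le_mul_of_nonneg_left hz (by positivity)).trans ?_)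
        rw [mul_pow] at h2
        linarith
      linarith [le_of_mul_le_mul_left h3 hs']
    have h4 : 32 * (mismatches L (blockAffine A t') z.1 z.2).card ≤
        15 * (innerBlocks n s L).card := le_trans (by exact_mod_cast h1) hG'
    -- If all inner blocks were mismatches, `h4` would give `32 ≤ 15` up to a positive factor.
    obtain ⟨g₀, hg₀, hg₀'⟩ : ∃ g ∈ innerBlocks n s L,
        g ∉ mismatches L (blockAffine A t') z.1 z.2 := by
      by_contra hcon
      push Not at hcon
      have h5 := Finset.card_le_card hcon
      have h6 : 0 < (m + 1) ^ 2 := by positivity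
      omega
    simp only [mismatches, Finset.mem_filter, hg₀, true_and, not_forall] at hg₀'
    obtain ⟨h₀, hh₀, -⟩ := hg₀'
    obtain ⟨e, he⟩ := exists_floorCode_blockAffine hC1 hC hA t' g₀ h₀ hh₀
    rw [show blockAffine A t' = τ e from funext he] at h4
    exact Finset.mem_biUnion.mpr ⟨e, Finset.mem_univ _, by simpa using h4⟩
  have hcode : ∀ e : Fin 2 → FloorCode (m + 1) (7 * C * (m + 1)),
      ((Finset.univ.filter fun z : BlockBits n s =>
        32 * (mismatches L (τ e) z.1 z.2).card ≤ 15 * (innerBlocks n s L).card).card : ℝ) ≤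
      2 ^ Fintype.card (Block n s) *
        (2 ^ Fintype.card (Block n s) * tailBase ^ (innerBlocks n s L).card) := by
    intro e
    -- Fix the second image `b`; the tail bound uses only the randomness of `a`.
    rw [Finset.card_filter, Fintype.sum_prod_type_right, Nat.cast_sum]
    have h1 := Finset.sum_le_card_nsmul (Finset.univ : Finset (Block n s → Bool))
      (fun b => ((Finset.univ.filter fun a : Block n s → Bool =>
        32 * (mismatches L (τ e) a b).card ≤ 15 * (innerBlocks n s L).card).card : ℝ)) _
      fun b _ => card_few_mismatches_map_le (τ e) b
    simp only [Finset.card_filter, Finset.card_univ, Fintype.card_fun, Fintype.card_bool,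
      nsmul_eq_mul, Nat.cast_pow, Nat.cast_ofNat] at h1
    exact h1
  have hcard := (Nat.cast_le (α := ℝ)).mpr ((Finset.card_le_card hsub).trans Finset.card_biUnion_le)
  rw [Nat.cast_sum] at hcard
  have h1 := hcard.trans (Finset.sum_le_card_nsmul _ _ _ fun e _ => hcode e)
  rw [Finset.card_univ, Fintype.card_fun, FloorCode.card, Fintype.card_fin, nsmul_eq_mul] at h1
  have h2 := hm₀ m L hm1 (by omega)
  have h3 : (Fintype.card (BlockBits n s) : ℝ) =
      2 ^ Fintype.card (Block n s) * 2 ^ Fintype.card (Block n s) := by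
    rw [Fintype.card_prod, Fintype.card_fun, Fintype.card_bool]
    push_cast
    rfl
  rw [h3]
  rw [hG] at h1
  push_cast at h1 h2
  have h4 : (0 : ℝ) ≤ 2 ^ Fintype.card (Block n s) * 2 ^ Fintype.card (Block n s) := by positivity
  have h5 := mul_le_mul_of_nonneg_left h2 h4
  rw [mul_one] at h5
  refine le_trans (mul_le_mul_of_nonneg_left h1 (by norm_num)) (le_trans (le_of_eq ?_) h5)
  ring

/-! ### Randomized algorithms -/

namespace RandomizedAlgorithm

variable {n : ℕ} (𝒜 : RandomizedAlgorithm n)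

/-- The expected value of a function of the deterministic algorithm. -/
noncomputable def mean (f : QueryTree n → ℝ≥0∞) : ℝ≥0∞ := ∑' D, 𝒜 D * f D

theorem mean_mono {f g : QueryTree n → ℝ≥0∞} (h : ∀ D, f D ≤ g D) : 𝒜.mean f ≤ 𝒜.mean g :=
  ENNReal.tsum_le_tsum fun D => mul_le_mul_right (h D) _

theorem mean_add (f g : QueryTree n → ℝ≥0∞) :
    𝒜.mean (fun D => f D + g D) = 𝒜.mean f + 𝒜.mean g := by
  simp only [mean, mul_add, ENNReal.tsum_add]

theorem mean_const_mul (a : ℝ≥0∞) (f : QueryTree n → ℝ≥0∞) :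
    𝒜.mean (fun D => a * f D) = a * 𝒜.mean f := by
  simp only [mean, ← ENNReal.tsum_mul_left, mul_left_comm]

theorem mean_sum {ι : Type*} (S : Finset ι) (f : ι → QueryTree n → ℝ≥0∞) :
    𝒜.mean (fun D => ∑ i ∈ S, f i D) = ∑ i ∈ S, 𝒜.mean (f i) := by
  simp only [mean, Finset.mul_sum]
  exact Summable.tsum_finsetSum fun i _ => ENNReal.summable

theorem mean_one : 𝒜.mean (fun _ => 1) = 1 := by
  simp only [mean, mul_one, 𝒜.tsum_coe]

theorem probOutput_eq_mean (M₁ M₂ : BinaryImage n) (b : Bool) :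
    𝒜.probOutput M₁ M₂ b = 𝒜.mean fun D => if D.output M₁ M₂ = b then 1 else 0 := by
  rw [probOutput, PMF.toOuterMeasure_apply, mean]
  refine tsum_congr fun D => ?_
  by_cases h : D.output M₁ M₂ = b
  · simp [Set.indicator, h]
  · simp [Set.indicator, h]

theorem probOutput_true_add_false (M₁ M₂ : BinaryImage n) :
    𝒜.probOutput M₁ M₂ true + 𝒜.probOutput M₁ M₂ false = 1 := by
  rw [probOutput_eq_mean, probOutput_eq_mean, ← mean_add]
  refine Eq.trans ?_ 𝒜.mean_one
  congr 1
  funext D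
  cases D.output M₁ M₂ <;> simp

theorem probOutput_false_le {M₁ M₂ : BinaryImage n} (h : 2 / 3 ≤ 𝒜.probOutput M₁ M₂ true) :
    𝒜.probOutput M₁ M₂ false ≤ 1 / 3 := by
  have h1 := 𝒜.probOutput_true_add_false M₁ M₂
  have h2 : (2 / 3 : ℝ≥0∞) + 1 / 3 = 1 := by
    rw [← ENNReal.add_div, ENNReal.div_eq_one_iff (by norm_num) (by norm_num)]
    norm_num
  have h3 : (2 / 3 : ℝ≥0∞) ≠ ⊤ := ENNReal.div_ne_top (by norm_num) (by norm_num)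
  refine (ENNReal.add_le_add_iff_left h3).mp ?_
  rw [h2, ← h1]
  exact add_le_add_left h _

/-- With probability at least `1/2`, an algorithm with a small expected number of queries is correct
after few queries. -/
theorem half_le_mean {M₁ M₂ : BinaryImage n} {b : Bool} {B : ℝ} {Q : ℕ}
    (h : 2 / 3 ≤ 𝒜.probOutput M₁ M₂ b) (hB : 𝒜.expectedQueries M₁ M₂ ≤ ENNReal.ofReal B)
    (hQ : 6 * B ≤ Q + 1) :
    1 / 2 ≤ 𝒜.mean fun D => if D.output M₁ M₂ = b ∧ D.numQueries M₁ M₂ ≤ Q then 1 else 0 := by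
  set P := 𝒜.mean fun D => if D.output M₁ M₂ = b ∧ D.numQueries M₁ M₂ ≤ Q then 1 else 0
  set R := 𝒜.mean fun D => if Q + 1 ≤ D.numQueries M₁ M₂ then 1 else 0 with hR
  have h1 : 2 / 3 ≤ P + R := by
    refine h.trans ?_
    rw [probOutput_eq_mean, ← mean_add]
    refine 𝒜.mean_mono fun D => ?_
    by_cases h1 : D.output M₁ M₂ = b
    · by_cases h2 : D.numQueries M₁ M₂ ≤ Q
      · simp [h1, h2]
      · have h3 : Q + 1 ≤ D.numQueries M₁ M₂ := by omega
        simp [h1, h2, h3]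
    · simp [h1]
  have h2 : ((Q + 1 : ℕ) : ℝ≥0∞) * R ≤ ENNReal.ofReal ((Q + 1) / 6) := by
    have h3 : ((Q + 1 : ℕ) : ℝ≥0∞) * R ≤ 𝒜.expectedQueries M₁ M₂ := by
      rw [hR, ← mean_const_mul]
      refine 𝒜.mean_mono fun D => ?_
      split_ifs with h4
      · rw [mul_one]
        exact_mod_cast h4
      · simp
    refine h3.trans (hB.trans (ENNReal.ofReal_le_ofReal ?_))
    linarith
  -- Markov's inequality; `1/6` is exactly the gap between `2/3` and `1/2`.
  have h3 : R ≤ ENNReal.ofReal (1 / 6) := by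
    have h4 : ENNReal.ofReal (((Q : ℝ) + 1) / 6) = ((Q + 1 : ℕ) : ℝ≥0∞) * ENNReal.ofReal (1 / 6) := by
      rw [← ENNReal.ofReal_natCast, ← ENNReal.ofReal_mul (Nat.cast_nonneg _)]
      congr 1
      push_cast
      ring
    rw [h4] at h2
    exact (ENNReal.mul_le_mul_iff_right (by simp) (ENNReal.natCast_ne_top _)).mp h2
  have h4 : (2 / 3 : ℝ≥0∞) = 1 / 2 + ENNReal.ofReal (1 / 6) := by
    rw [← ENNReal.toReal_eq_toReal_iff' (ENNReal.div_ne_top (by norm_num) (by norm_num))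
      (ENNReal.add_ne_top.mpr ⟨ENNReal.div_ne_top (by norm_num) (by norm_num),
        ENNReal.ofReal_ne_top⟩),
      ENNReal.toReal_add (ENNReal.div_ne_top (by norm_num) (by norm_num)) ENNReal.ofReal_ne_top,
      ENNReal.toReal_ofReal (by norm_num)]
    norm_num
  rw [h4] at h1
  exact (ENNReal.add_le_add_iff_right ENNReal.ofReal_ne_top).mp (h1.trans (add_le_add_right h3 P))

end RandomizedAlgorithm

/-! ### The indistinguishability argument and the choice of parameters. -/

theorem NeedsQueries.mono {c : ℝ} {n : ℕ} {S S' : Set (BinaryImage n × BinaryImage n)} {b : ℝ}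
    (hS : S ⊆ S') (h : NeedsQueries c S b) : NeedsQueries c S' b := by
  intro 𝒜 h𝒜
  obtain ⟨M₁, M₂, hM, h1⟩ := h 𝒜 fun M₁ M₂ hM => h𝒜 M₁ M₂ (hS hM)
  exact ⟨M₁, M₂, hS hM, h1⟩

open Classical in
/-- Block images with independent bits cannot be told apart from those with a planted translate. -/
theorem needsQueries_of_blockImages {c : ℝ} {n s L Q : ℕ} {B : ℝ} (V : Finset (ℕ × ℕ))
    (hV : V.Nonempty) {S : Set (BinaryImage n × BinaryImage n)}
    (hS : ∀ a b : Block n s → Bool, (blockImage (striped L a), blockImage b) ∈ S)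
    (hfar : 10 * ((Finset.univ.filter fun z : BlockBits n s =>
      imageDist c (blockImage (striped L z.1)) (blockImage z.2) ≤ 7 / 16).card : ℝ) ≤
      Fintype.card (BlockBits n s))
    (hnear : ∀ v ∈ V, ∀ a b : Block n s → Bool,
      imageDist c (blockImage (striped L a)) (blockImage (plant L v a b)) < 4 / 16)
    (hQV : 100 * Q ^ 2 ≤ V.card) (hBQ : 6 * B ≤ Q + 1) :
    NeedsQueries c S B := by
  intro 𝒜 h𝒜
  by_contra hcon
  push Not at hcon
  set F : QueryTree n → ℕ := fun D => (Finset.univ.filter fun z : BlockBits n s =>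
    D.output (blockImage (striped L z.1)) (blockImage z.2) = false ∧
      D.numQueries (blockImage (striped L z.1)) (blockImage z.2) ≤ Q).card
  set N : QueryTree n → ℕ := fun D => ∑ v ∈ V, (Finset.univ.filter fun z : BlockBits n s =>
    D.output (blockImage (striped L z.1)) (blockImage (plant L v z.1 z.2)) = false).card
  set X := 𝒜.mean fun D => (F D : ℝ≥0∞) with hX
  set Z := 𝒜.mean fun D => (N D : ℝ≥0∞) with hZ
  set Ω : ℕ := Fintype.card (BlockBits n s) with hΩ
  -- The counting bound for single trees is averaged over the random tree.
  have hmain : (V.card : ℝ≥0∞) * X ≤ Z + ((Q ^ 2 : ℕ) : ℝ≥0∞) * X := by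
    rw [hX, hZ, ← 𝒜.mean_const_mul, ← 𝒜.mean_const_mul, ← 𝒜.mean_add]
    refine 𝒜.mean_mono fun D => ?_
    exact_mod_cast D.card_mul_card_le L V false Q
  have hZle : Z ≤ ((V.card * Ω : ℕ) : ℝ≥0∞) * (1 / 3) := by
    have h1 : Z = ∑ v ∈ V, ∑ z : BlockBits n s,
        𝒜.probOutput (blockImage (striped L z.1)) (blockImage (plant L v z.1 z.2)) false := by
      simp only [RandomizedAlgorithm.probOutput_eq_mean, ← RandomizedAlgorithm.mean_sum, hZ, N,
        Finset.card_filter, Nat.cast_sum, Nat.cast_ite, Nat.cast_one, Nat.cast_zero]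
    rw [h1]
    have h2 : ∀ v ∈ V, ∑ z : BlockBits n s,
        𝒜.probOutput (blockImage (striped L z.1)) (blockImage (plant L v z.1 z.2)) false ≤
          (Ω : ℝ≥0∞) * (1 / 3) := by
      intro v hv
      rw [hΩ, ← Finset.card_univ, ← nsmul_eq_mul]
      exact Finset.sum_le_card_nsmul _ _ _ fun z _ =>
        𝒜.probOutput_false_le ((h𝒜 _ _ (hS z.1 _)).1 (hnear v hv z.1 z.2))
    refine (Finset.sum_le_card_nsmul _ _ _ h2).trans_eq ?_
    rw [nsmul_eq_mul, ← mul_assoc, ← Nat.cast_mul]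
  set G := Finset.univ.filter fun z : BlockBits n s =>
    ¬ imageDist c (blockImage (striped L z.1)) (blockImage z.2) ≤ 7 / 16 with hG
  have hXsum : X = ∑ z : BlockBits n s, 𝒜.mean fun D =>
      if D.output (blockImage (striped L z.1)) (blockImage z.2) = false ∧
        D.numQueries (blockImage (striped L z.1)) (blockImage z.2) ≤ Q then 1 else 0 := by
    simp only [← RandomizedAlgorithm.mean_sum, hX, F,
        Finset.card_filter, Nat.cast_sum, Nat.cast_ite, Nat.cast_one, Nat.cast_zero]
  have hXge : (G.card : ℝ≥0∞) * (1 / 2) ≤ X := by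
    rw [hXsum, ← nsmul_eq_mul]
    refine (Finset.card_nsmul_le_sum G _ _ fun z hz => ?_).trans
      (Finset.sum_le_sum_of_subset (Finset.subset_univ G))
    have hz' := not_le.mp (Finset.mem_filter.mp hz).2
    exact 𝒜.half_le_mean ((h𝒜 _ _ (hS z.1 z.2)).2 hz')
      (hcon _ _ (hS z.1 z.2) (Or.inr hz')).le hBQ
  have hXtop : X ≠ ⊤ := by
    refine ne_top_of_le_ne_top (ENNReal.natCast_ne_top Ω) ?_
    have : X ≤ 𝒜.mean fun _ => (Ω : ℝ≥0∞) * 1 := by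
      refine 𝒜.mean_mono fun D => ?_
      rw [mul_one]
      exact Nat.cast_le.mpr (Finset.card_le_univ _)
    rwa [𝒜.mean_const_mul, 𝒜.mean_one, mul_one] at this
  have h13 : (1 / 3 : ℝ≥0∞) ≠ ⊤ := ENNReal.div_ne_top (by norm_num) (by norm_num)
  have hZtop : ((V.card * Ω : ℕ) : ℝ≥0∞) * (1 / 3) ≠ ⊤ :=
    ENNReal.mul_ne_top (ENNReal.natCast_ne_top _) h13
  have hQtop : ((Q ^ 2 : ℕ) : ℝ≥0∞) * X ≠ ⊤ := ENNReal.mul_ne_top (ENNReal.natCast_ne_top _) hXtop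
  have r1 := ENNReal.toReal_mono (ENNReal.add_ne_top.mpr ⟨hZtop, hQtop⟩)
    (hmain.trans (add_le_add_left hZle _))
  rw [ENNReal.toReal_add hZtop hQtop, ENNReal.toReal_mul, ENNReal.toReal_mul, ENNReal.toReal_mul,
    ENNReal.toReal_natCast, ENNReal.toReal_natCast, ENNReal.toReal_natCast, ENNReal.toReal_div,
    ENNReal.toReal_one, ENNReal.toReal_ofNat] at r1
  have r2 := ENNReal.toReal_mono hXtop hXge
  rw [ENNReal.toReal_mul, ENNReal.toReal_natCast, ENNReal.toReal_div, ENNReal.toReal_one,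
    ENNReal.toReal_ofNat] at r2
  have r3 : 9 / 10 * (Ω : ℝ) ≤ G.card := by
    have h1 := Finset.card_filter_add_card_filter_not (s := (Finset.univ : Finset (BlockBits n s)))
      (fun z => imageDist c (blockImage (striped L z.1)) (blockImage z.2) ≤ 7 / 16)
    rw [Finset.card_univ, ← hΩ, ← hG] at h1
    have h2 : (Ω : ℝ) = _ := congrArg (Nat.cast (R := ℝ)) h1.symm
    rw [Nat.cast_add] at h2
    linarith
  have r4 : (100 * (Q ^ 2 : ℕ) : ℝ) ≤ V.card := by exact_mod_cast hQV
  have r5 : (0 : ℝ) < V.card := by exact_mod_cast hV.card_pos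
  have r6 : (0 : ℝ) < Ω := by exact_mod_cast Fintype.card_pos
  have r7 : 0 ≤ X.toReal := ENNReal.toReal_nonneg
  push_cast at r1
  push_cast at r4
  have r8 := mul_le_mul_of_nonneg_right r4 r7
  -- Nine tenths of the inputs are far, each contributing at least `1/2`. On the other side `r1` and
  -- `r8` give `99/100 * X ≤ Ω / 3`, which is incompatible.
  have r9 : 45 / 100 * (Ω : ℝ) ≤ X.toReal := by linarith
  have r10 := mul_le_mul_of_nonneg_left r9 r5.le
  have r11 := mul_pos r5 r6
  linarith

/-- The lower bound for a fixed block length. -/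
theorem needsQueries_perimeter {c : ℝ} (hc : 1 ≤ c) : ∃ m₀ : ℕ, ∀ (n : ℕ) (k : ℝ), 1 ≤ k →
    (m₀ : ℝ) * k ≤ n → NeedsQueries c
      {M : BinaryImage n × BinaryImage n | 1 / 2048 * ((n : ℝ) ^ 2 / k) ≤ maxPerimeter M ∧
        maxPerimeter M ≤ 10 * ((n : ℝ) ^ 2 / k)} (1 / 7680 * ((n : ℝ) / k)) := by
  obtain ⟨m₀, hm₀⟩ := exists_card_imageDist_le hc
  refine ⟨2 * (m₀ + 64), fun n k hk hn => ?_⟩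
  have hk0 : 0 < k := by linarith
  set s := ⌈k⌉₊ with hs_def
  have hs : 0 < s := Nat.ceil_pos.mpr hk0
  have hs1 : k ≤ s := Nat.le_ceil k
  have hs2 : (s : ℝ) ≤ 2 * k := by
    have := Nat.ceil_lt_add_one hk0.le
    linarith
  have hs0 : (0 : ℝ) < s := by linarith
  have hm : m₀ + 64 ≤ n / s := by
    rw [Nat.le_div_iff_mul_le hs, ← Nat.cast_le (α := ℝ)]
    push_cast at hn ⊢
    have : ((m₀ : ℝ) + 64) * s ≤ (m₀ + 64) * (2 * k) :=
      mul_le_mul_of_nonneg_left hs2 (by positivity)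
    linarith
  set m := n / s with hm_def
  set L := m / 64 with hL
  set w := m / 16 with hw
  have hn1 : (s * m : ℝ) ≤ n := by exact_mod_cast Nat.mul_div_le n s
  have hm64 : (64 : ℝ) ≤ m := by
    have : 64 ≤ m := by omega
    exact_mod_cast this
  have hn2 : (n : ℝ) ≤ 2 * (s * m) := by
    have h1 : (n : ℝ) ≤ s * (m + 1) := by exact_mod_cast (Nat.lt_mul_div_succ n hs).le
    nlinarith
  have hn0 : (0 : ℝ) < n := by nlinarith
  have hkm : (n : ℝ) / k ≤ 4 * m := by
    rw [div_le_iff₀ hk0]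
    nlinarith
  have hw1 : (m : ℝ) ≤ 32 * w := by
    have : m ≤ 32 * w := by omega
    exact_mod_cast this
  have hL1 : (m : ℝ) ≤ 128 * L := by
    have : m ≤ 128 * L := by omega
    exact_mod_cast this
  -- The constant `7680 = 6 * 4 * 32 * 10` collects the factor in `hBQ`, the bounds `hkm` and `hw1`,
  -- and the `10` needed for `100 * Q ^ 2 ≤ w ^ 2`.
  have hQ : (⌊6 * (1 / 7680 * ((n : ℝ) / k))⌋₊ : ℝ) ≤ w / 10 := by
    refine (Nat.floor_le (by positivity)).trans ?_
    linarith
  refine needsQueries_of_blockImages (s := s) (L := L)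
    (Q := ⌊6 * (1 / 7680 * ((n : ℝ) / k))⌋₊) (Finset.range w ×ˢ Finset.range w) ?_ ?_
    (hm₀ n s hs (by omega)) ?_ ?_ (Nat.lt_floor_add_one _).le
  · exact ⟨(0, 0), by simp only [Finset.mem_product, Finset.mem_range]; omega⟩
  · intro a b
    have h1 := perimeter_blockImage_le hs (striped L a)
    have h2 := perimeter_blockImage_le hs b
    have h3 := le_perimeter_striped hs (Nat.div_le_self m 64) a
    -- Here `2048 = 8 * 256`, from `n ^ 2 / k ≤ 8 * s * m ^ 2` and `m ^ 2 ≤ 256 * L * (m - 1)`.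
    have h4 : 1 / 2048 * ((n : ℝ) ^ 2 / k) ≤ ((L * s * (m - 1) : ℕ) : ℝ) := by
      have h5 : (m : ℝ) ≤ 2 * ((m - 1 : ℕ) : ℝ) := by
        have : m ≤ 2 * (m - 1) := by omega
        exact_mod_cast this
      have h6 : (n : ℝ) ^ 2 / k ≤ 2 * (s * m) * (4 * m) := by
        rw [sq, mul_div_assoc]
        exact mul_le_mul hn2 hkm (by positivity) (by positivity)
      have h7 : (m : ℝ) * m ≤ 128 * L * (2 * ((m - 1 : ℕ) : ℝ)) :=
        mul_le_mul hL1 h5 (by positivity) (by positivity)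
      have h8 := mul_le_mul_of_nonneg_left h7 hs0.le
      rw [Nat.cast_mul, Nat.cast_mul]
      linarith
    have h9 : ((2 * n * (2 * (m + 1) + 1) : ℕ) : ℝ) ≤ 10 * ((n : ℝ) ^ 2 / k) := by
      have h10 : (m : ℝ) ≤ n / k := by
        rw [le_div_iff₀ hk0]
        nlinarith
      have h11 := mul_le_mul_of_nonneg_left h10 hn0.le
      rw [sq, mul_div_assoc]
      push_cast
      nlinarith
    refine ⟨h4.trans (Nat.cast_le.mpr (h3.trans (le_max_left _ _))), le_trans ?_ h9⟩
    exact Nat.cast_le.mpr (max_le h1 h2)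
  · rintro ⟨v₁, v₂⟩ hv a b
    simp only [Finset.mem_product, Finset.mem_range] at hv
    refine (imageDist_blockImage_le hc hs (v₁ := v₁) (v₂ := v₂) (L := L) _ _
      fun g h hg h1 h2 => striped_eq_plant (v := (v₁, v₂)) a b g h hg h1 h2).trans_lt ?_
    -- Two shifts below `m / 16` and `L ≤ m / 64` give a distance of at most `9/64 < 4/16`.
    have h1 : (64 * (v₁ + v₂ + L) : ℝ) ≤ 9 * m := by
      have : 64 * (v₁ + v₂ + L) ≤ 9 * m := by omega
      exact_mod_cast this
    have h2 := mul_le_mul_of_nonneg_left h1 hs0.le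
    rw [one_div_mul_eq_div, div_lt_iff₀ (by positivity)]
    push_cast
    nlinarith
  · rw [Finset.card_product, Finset.card_range, ← Nat.cast_le (α := ℝ)]
    push_cast
    nlinarith [Nat.cast_nonneg (α := ℝ) ⌊6 * (1 / 7680 * ((n : ℝ) / k))⌋₊]

end ImageMatching

open ImageMatching
theorem mainTheorem2 :
    ∃ α β γ : ℝ, 0 < α ∧ 0 < β ∧ 0 < γ ∧ ∀ c : ℝ, 1 ≤ c →
      (∀ k : ℕ → ℝ, (∀ n, 1 ≤ k n) → k =o[atTop] (fun n : ℕ => (n : ℝ)) →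
        (∀ᶠ n : ℕ in atTop,
          NeedsQueries c
            {M : BinaryImage n × BinaryImage n | α * ((n : ℝ) ^ 2 / k n) ≤ maxPerimeter M}
            (γ * ((n : ℝ) / k n))) ∧
        (∀ᶠ n : ℕ in atTop,
          NeedsQueries c
            {M : BinaryImage n × BinaryImage n | α * ((n : ℝ) ^ 2 / k n) ≤ maxPerimeter M ∧
              maxPerimeter M ≤ β * ((n : ℝ) ^ 2 / k n)}
            (γ * ((n : ℝ) / k n)))) ∧
      (∀ᶠ n : ℕ in atTop,
        NeedsQueries c (Set.univ : Set (BinaryImage n × BinaryImage n)) (γ * (n : ℝ))) := by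
  refine ⟨1 / 2048, 10, 1 / 7680, by norm_num, by norm_num, by norm_num, fun c hc => ?_⟩
  obtain ⟨m₀, hm₀⟩ := needsQueries_perimeter hc
  refine ⟨fun k hk hko => ?_, ?_⟩
  · have h : ∀ᶠ n : ℕ in atTop, NeedsQueries c
        {M : BinaryImage n × BinaryImage n | 1 / 2048 * ((n : ℝ) ^ 2 / k n) ≤ maxPerimeter M ∧
          maxPerimeter M ≤ 10 * ((n : ℝ) ^ 2 / k n)} (1 / 7680 * ((n : ℝ) / k n)) := by
      filter_upwards [hko.def (show (0 : ℝ) < 1 / (m₀ + 1) by positivity)] with n hn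
      refine hm₀ n (k n) (hk n) ?_
      have hkn := hk n
      rw [Real.norm_of_nonneg (by linarith), Real.norm_of_nonneg (Nat.cast_nonneg n),
        one_div_mul_eq_div, le_div_iff₀ (by positivity)] at hn
      nlinarith
    exact ⟨h.mono fun n hn => hn.mono fun M hM => hM.1, h⟩
  · filter_upwards [eventually_ge_atTop m₀] with n hn
    -- The class of all pairs contains the class for block length `k = 1`.
    rw [← div_one (n : ℝ)]
    exact (hm₀ n 1 le_rfl (by rw [mul_one]; exact_mod_cast hn)).mono (Set.subset_univ _)
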